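/- Let $\kappa \in (0,8)\setminus\mathbb{Q}$ and $q = e^{4\pi \mathrm{i}/\kappa}$ (so $q$ is not a root of unity), and let $[2] = q+q^{-1}$. Let $\mathcal{U}_q(\mathfrak{sl}_2)$ be the associative unital $\mathbb{C}$-algebra with generators $E,F,K,K^{-1}$ and relations $KK^{-1}=1=K^{-1}K$, $KE=q^2EK$, $KF=q^{-2}FK$, $EF-FE=\frac{1}{q-q^{-1}}(K-K^{-1})$, with the coproduct $\Delta(E)=E\otimes K+1\otimes E$, $\Delta(K)=K\otimes K$, $\Delta(F)=F\otimes 1+K^{-1}\otimes F$. Let $\mathsf{M}_2$ be its two-dimensional representation with basis $e_0,e_1$ and $K.e_0=q\,e_0$, $K.e_1=q^{-1}e_1$, $F.e_0=e_1$, $F.e_1=0$, $E.e_0=0$, $E.e_1=e_0$. The tensor powers $\mathsf{M}_2^{\otimes n}$ are representations through the coproduct, and $\mathsf{M}_2^{\otimes 0}=\mathbb{C}$ is the trivial representation ($K.1=1$, $E.1=F.1=0$). Let $\hat\pi\colon \mathsf{M}_2\otimes\mathsf{M}_2\to\mathbb{C}$ be the linear map with $\hat\pi(s)=1$ for the singlet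 vector $s=\frac{1}{q-q^{-1}}(e_1\otimes e_0-q\,e_0\otimes e_1)$ and with $\hat\pi=0$ on the triplet subspace spanned by $e_0\otimes e_0$, $q^{-1}e_0\otimes e_1+e_1\otimes e_0$ and $[2]\,e_1\otimes e_1$. For $1\le j<n$ let $\hat\pi_j=\mathrm{id}^{\otimes(n-1-j)}\otimes\hat\pi\otimes\mathrm{id}^{\otimes(j-1)}\colon \mathsf{M}_2^{\otimes n}\to\mathsf{M}_2^{\otimes(n-2)}$, which acts on the components $j$ and $j+1$ counted from the right. For $N\ge 0$, a link pattern $\alpha$ of $|\alpha|=N$ links is a planar (non-crossing) partition of $\{1,\dots,2N\}$ into pairs, called links and denoted $[a,b]$; the only link pattern with $N=0$ is $\emptyset$. If $[j,j+1]\in\alpha$, let $\alpha/[j,j+1]$ be the link pattern of $|\alpha|-1$ links obtained by removing $[j,j+1]$ and reducing all indices greater than $j+1$ by two. Then there is a unique collection $(v_\alpha)_\alpha$ of vectors $v_\alpha\in\mathsf{M}_2^{\otimes 2|\alpha|}$, indexed by all link patterns $\alpha$ of all sizes, such that $v_\emptyset=1$ and, for every link pattern $\alpha$, $$K.v_\alpha=v_\alpha,\qquad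 E.v_\alpha=0,$$ $$\hat\pi_j(v_\alpha)=\begin{cases}v_{\alpha/[j,j+1]} & \text{if } [j,j+1]\in\alpha,\\ 0 & \text{if } [j,j+1]\notin\alpha,\end{cases}\qquad\text{for all } j=1,\dots,2|\alpha|-1.$$ -/

import Mathlib

open scoped TensorProduct

namespace MultipleSLE

/-! ### The quantum group -/

/-- The deformation parameters: nonzero complex numbers that are not roots of unity. -/
def GenericParam : Type := {q : ℂ // q ≠ 0 ∧ ∀ n : ℕ, 0 < n → q ^ n ≠ 1}

/-- The underlying complex number of a deformation parameter. -/
@[coe] def GenericParam.val (q : GenericParam) : ℂ := Subtype.val q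

instance : CoeOut GenericParam ℂ := ⟨GenericParam.val⟩

theorem GenericParam.ne_zero (q : GenericParam) : (q : ℂ) ≠ 0 := q.2.1

theorem GenericParam.pow_ne_one (q : GenericParam) {n : ℕ} (hn : 0 < n) : (q : ℂ) ^ n ≠ 1 :=
  q.2.2 n hn

theorem GenericParam.sub_inv_ne_zero (q : GenericParam) : (q : ℂ) - (q : ℂ)⁻¹ ≠ 0 := by
  intro h
  apply q.pow_ne_one (n := 2) (by norm_num)
  have h0 := q.ne_zero
  field_simp at h
  linear_combination h

theorem GenericParam.add_inv_ne_zero (q : GenericParam) : (q : ℂ) + (q : ℂ)⁻¹ ≠ 0 := by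
  intro h
  apply q.pow_ne_one (n := 4) (by norm_num)
  have h0 := q.ne_zero
  field_simp at h
  linear_combination ((q : ℂ) ^ 2 - 1) * h

/-- For irrational `κ`, the number `exp (4 π i / κ)` is not a root of unity. -/
theorem exp_generic {κ : ℝ} (hκ : Irrational κ) :
    Complex.exp (Complex.I * 4 * Real.pi / κ) ≠ 0 ∧
      ∀ n : ℕ, 0 < n → Complex.exp (Complex.I * 4 * Real.pi / κ) ^ n ≠ 1 := by
  refine ⟨Complex.exp_ne_zero _, fun n hn h => ?_⟩
  rw [← Complex.exp_nat_mul, Complex.exp_eq_one_iff] at h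
  obtain ⟨m, hm⟩ := h
  have hκ0 : (κ : ℂ) ≠ 0 := by exact_mod_cast hκ.ne_zero
  have hpi : (Real.pi : ℂ) ≠ 0 := by exact_mod_cast Real.pi_ne_zero
  have hI : Complex.I ≠ 0 := Complex.I_ne_zero
  have h2 : (m : ℂ) * κ = 2 * n := by
    field_simp at hm
    linear_combination -(1 / 2 : ℂ) * hm
  have h3 : (m : ℝ) * κ = 2 * n := by exact_mod_cast h2
  have hm0 : m ≠ 0 := by
    rintro rfl
    have : (0 : ℝ) < n := by exact_mod_cast hn
    simp at h3
    omega
  have hm1 : (m : ℝ) ≠ 0 := by exact_mod_cast hm0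
  apply hκ
  refine ⟨(2 * n : ℚ) / m, ?_⟩
  push_cast
  rw [← h3]
  field_simp

/-- The deformation parameter `q = exp (4 π i / κ)`. -/
noncomputable def qParam (κ : ℝ) (hκ : Irrational κ) : GenericParam :=
  ⟨Complex.exp (Complex.I * 4 * Real.pi / κ), exp_generic hκ⟩

/-- The generators of the quantum group. -/
inductive Gen : Type
  | E : Gen
  | F : Gen
  | K : Gen
  | Kinv : Gen

open FreeAlgebra in
/-- The defining relations of `U_q(sl₂)`. -/
inductive UqRel (q : GenericParam) : FreeAlgebra ℂ Gen → FreeAlgebra ℂ Gen → Prop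
  | K_Kinv : UqRel q (ι ℂ Gen.K * ι ℂ Gen.Kinv) 1
  | Kinv_K : UqRel q (ι ℂ Gen.Kinv * ι ℂ Gen.K) 1
  | K_E : UqRel q (ι ℂ Gen.K * ι ℂ Gen.E) ((q : ℂ) ^ (2 : ℤ) • (ι ℂ Gen.E * ι ℂ Gen.K))
  | K_F : UqRel q (ι ℂ Gen.K * ι ℂ Gen.F) ((q : ℂ) ^ (-2 : ℤ) • (ι ℂ Gen.F * ι ℂ Gen.K))
  | E_F : UqRel q (ι ℂ Gen.E * ι ℂ Gen.F - ι ℂ Gen.F * ι ℂ Gen.E)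
      ((1 / ((q : ℂ) - (q : ℂ)⁻¹)) • (ι ℂ Gen.K - ι ℂ Gen.Kinv))

/-- The quantum group `U_q(sl₂)` as an associative unital algebra. -/
abbrev Uq (q : GenericParam) : Type := RingQuot (UqRel q)

namespace Uq

variable (q : GenericParam)

/-- A generator as an element of `U_q(sl₂)`. -/
noncomputable def gen (g : Gen) : Uq q := RingQuot.mkAlgHom ℂ (UqRel q) (FreeAlgebra.ι ℂ g)

/-- The generator `E`. -/
noncomputable abbrev E : Uq q := gen q Gen.E
/-- The generator `F`. -/
noncomputable abbrev F : Uq q := gen q Gen.F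
/-- The generator `K`. -/
noncomputable abbrev K : Uq q := gen q Gen.K
/-- The generator `K⁻¹`. -/
noncomputable abbrev Kinv : Uq q := gen q Gen.Kinv

theorem K_mul_Kinv : K q * Kinv q = 1 := by
  have h := RingQuot.mkAlgHom_rel ℂ (UqRel.K_Kinv (q := q))
  simpa only [map_mul, map_one, gen] using h

theorem Kinv_mul_K : Kinv q * K q = 1 := by
  have h := RingQuot.mkAlgHom_rel ℂ (UqRel.Kinv_K (q := q))
  simpa only [map_mul, map_one, gen] using h

theorem K_mul_E : K q * E q = (q : ℂ) ^ (2 : ℤ) • (E q * K q) := by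
  have h := RingQuot.mkAlgHom_rel ℂ (UqRel.K_E (q := q))
  simpa only [map_mul, map_smul, gen] using h

theorem K_mul_F : K q * F q = (q : ℂ) ^ (-2 : ℤ) • (F q * K q) := by
  have h := RingQuot.mkAlgHom_rel ℂ (UqRel.K_F (q := q))
  simpa only [map_mul, map_smul, gen] using h

theorem E_mul_F : E q * F q - F q * E q = (1 / ((q : ℂ) - (q : ℂ)⁻¹)) • (K q - Kinv q) := by
  have h := RingQuot.mkAlgHom_rel ℂ (UqRel.E_F (q := q))
  simpa only [map_mul, map_smul, map_sub, gen] using h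

theorem E_mul_Kinv : E q * Kinv q = (q : ℂ) ^ (2 : ℤ) • (Kinv q * E q) := by
  calc E q * Kinv q = Kinv q * (K q * E q) * Kinv q := by
        rw [← mul_assoc (Kinv q), Kinv_mul_K, one_mul]
    _ = (q : ℂ) ^ (2 : ℤ) • (Kinv q * E q) := by
        rw [K_mul_E, mul_smul_comm, smul_mul_assoc, mul_assoc, mul_assoc, K_mul_Kinv, mul_one]

/-- The universal property of `U_q(sl₂)`: images of the generators that satisfy the defining
relations extend to an algebra homomorphism. -/
noncomputable def lift {A : Type*} [Ring A] [Algebra ℂ A] (f : Gen → A)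
    (h₁ : f Gen.K * f Gen.Kinv = 1) (h₂ : f Gen.Kinv * f Gen.K = 1)
    (h₃ : f Gen.K * f Gen.E = (q : ℂ) ^ (2 : ℤ) • (f Gen.E * f Gen.K))
    (h₄ : f Gen.K * f Gen.F = (q : ℂ) ^ (-2 : ℤ) • (f Gen.F * f Gen.K))
    (h₅ : f Gen.E * f Gen.F - f Gen.F * f Gen.E =
      (1 / ((q : ℂ) - (q : ℂ)⁻¹)) • (f Gen.K - f Gen.Kinv)) : Uq q →ₐ[ℂ] A :=
  RingQuot.liftAlgHom ℂ ⟨FreeAlgebra.lift ℂ f, by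
    intro x y h
    cases h <;> simpa only [map_mul, map_one, map_smul, map_sub, FreeAlgebra.lift_ι_apply]⟩

@[simp] theorem lift_gen {A : Type*} [Ring A] [Algebra ℂ A] (f : Gen → A) (h₁ h₂ h₃ h₄ h₅)
    (g : Gen) : lift q f h₁ h₂ h₃ h₄ h₅ (gen q g) = f g := by
  simp [lift, gen]

/-- The coproduct, given on the generators by `Δ(E) = E ⊗ K + 1 ⊗ E`, `Δ(K) = K ⊗ K`,
`Δ(F) = F ⊗ 1 + K⁻¹ ⊗ F` (and so `Δ(K⁻¹) = K⁻¹ ⊗ K⁻¹`). -/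
noncomputable def comul : Uq q →ₐ[ℂ] Uq q ⊗[ℂ] Uq q :=
  lift q
    (fun
      | .E => E q ⊗ₜ[ℂ] K q + 1 ⊗ₜ[ℂ] E q
      | .F => F q ⊗ₜ[ℂ] 1 + Kinv q ⊗ₜ[ℂ] F q
      | .K => K q ⊗ₜ[ℂ] K q
      | .Kinv => Kinv q ⊗ₜ[ℂ] Kinv q)
    (by simp [K_mul_Kinv, Algebra.TensorProduct.one_def])
    (by simp [Kinv_mul_K, Algebra.TensorProduct.one_def])
    (by simp only [mul_add, add_mul, Algebra.TensorProduct.tmul_mul_tmul, mul_one, one_mul,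
          K_mul_E, smul_add, TensorProduct.smul_tmul', TensorProduct.tmul_smul])
    (by simp only [mul_add, add_mul, Algebra.TensorProduct.tmul_mul_tmul, mul_one, one_mul,
          K_mul_F, K_mul_Kinv, Kinv_mul_K, smul_add, TensorProduct.smul_tmul',
          TensorProduct.tmul_smul])
    (by
      have hE : E q * F q = F q * E q + (1 / ((q : ℂ) - (q : ℂ)⁻¹)) • (K q - Kinv q) := by
        rw [← E_mul_F]; abel
      have hq : (q : ℂ) ^ (-2 : ℤ) * (q : ℂ) ^ (2 : ℤ) = 1 := by
        rw [← zpow_add₀ q.ne_zero]; norm_num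
      simp only [mul_add, add_mul, Algebra.TensorProduct.tmul_mul_tmul, mul_one, one_mul,
        K_mul_F, E_mul_Kinv, hE, TensorProduct.add_tmul, TensorProduct.tmul_add,
        ← TensorProduct.smul_tmul', TensorProduct.tmul_smul, smul_smul, hq, one_smul,
        TensorProduct.sub_tmul, TensorProduct.tmul_sub, smul_sub]
      abel)

/-- The counit `ε(E) = ε(F) = 0`, `ε(K) = 1`. It gives the action on the trivial
representation `ℂ`. -/
noncomputable def counit : Uq q →ₐ[ℂ] ℂ :=
  lift q
    (fun
      | .E => 0
      | .F => 0
      | .K => 1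
      | .Kinv => 1)
    (by simp) (by simp) (by simp) (by simp) (by simp)

end Uq

/-! ### The two-dimensional representation and its tensor powers -/

/-- The space `M₂ = ℂ²`, with standard basis `e 0`, `e 1`. -/
abbrev M₂ : Type := Fin 2 → ℂ

/-- The basis vectors of `M₂`. -/
def e (l : Fin 2) : M₂ := Pi.single l 1

/-- The representation `M₂`: `K e₀ = q e₀`, `K e₁ = q⁻¹ e₁`, `F e₀ = e₁`, `F e₁ = 0`,
`E e₀ = 0`, `E e₁ = e₀`. -/
noncomputable def repM₂ (q : GenericParam) : Uq q →ₐ[ℂ] Module.End ℂ M₂ :=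
  (Matrix.toLinAlgEquiv' : Matrix (Fin 2) (Fin 2) ℂ ≃ₐ[ℂ] Module.End ℂ M₂).toAlgHom.comp <|
    Uq.lift q
      (fun
        | .E => !![0, 1; 0, 0]
        | .F => !![0, 0; 1, 0]
        | .K => !![(q : ℂ), 0; 0, (q : ℂ)⁻¹]
        | .Kinv => !![(q : ℂ)⁻¹, 0; 0, (q : ℂ)])
      (by have := q.ne_zero; simp [Matrix.one_fin_two, this])
      (by have := q.ne_zero; simp [Matrix.one_fin_two, this])
      (by
        have := q.ne_zero
        ext i j; fin_cases i <;> fin_cases j <;> simp; field_simp)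
      (by
        have := q.ne_zero
        ext i j; fin_cases i <;> fin_cases j <;> simp [zpow_neg]; field_simp)
      (by
        have h := q.sub_inv_ne_zero
        ext i j; fin_cases i <;> fin_cases j <;> simp [h]
        rw [← neg_sub (q : ℂ), mul_neg, inv_mul_cancel₀ h])

theorem repM₂_values (q : GenericParam) :
    repM₂ q (Uq.K q) (e 0) = (q : ℂ) • e 0 ∧ repM₂ q (Uq.K q) (e 1) = (q : ℂ)⁻¹ • e 1 ∧
    repM₂ q (Uq.F q) (e 0) = e 1 ∧ repM₂ q (Uq.F q) (e 1) = 0 ∧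
    repM₂ q (Uq.E q) (e 0) = 0 ∧ repM₂ q (Uq.E q) (e 1) = e 0 := by
  refine ⟨?_, ?_, ?_, ?_, ?_, ?_⟩ <;>
  · ext i
    fin_cases i <;> simp [repM₂, e, Matrix.toLinAlgEquiv'_apply]

/-- The tensor power `M₂^{⊗n}`. Tensor components are counted **from the right**: the index
`i : Fin n` stands for the `(i+1)`-st component from the right, so that `tprod ℂ x` is
`x (n-1) ⊗ ⋯ ⊗ x 1 ⊗ x 0`. -/
abbrev M₂Pow (n : ℕ) : Type := ⨂[ℂ]^n M₂

/-- The identification `M₂ ⊗ M₂^{⊗n} ≃ M₂^{⊗(n+1)}`, which adds a component at the left end. -/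
noncomputable def consEquiv (n : ℕ) : M₂ ⊗[ℂ] M₂Pow n ≃ₗ[ℂ] M₂Pow (n + 1) :=
  (TensorProduct.comm ℂ M₂ (M₂Pow n)).trans <|
    (TensorProduct.congr (LinearEquiv.refl ℂ (M₂Pow n))
      (PiTensorProduct.subsingletonEquiv (R := ℂ) (s := fun _ : Fin 1 => M₂) 0).symm).trans
      TensorPower.mulEquiv

theorem consEquiv_tmul_tprod (n : ℕ) (y : M₂) (x : Fin n → M₂) :
    consEquiv n (y ⊗ₜ PiTensorProduct.tprod ℂ x) =
      PiTensorProduct.tprod ℂ (Fin.snoc (α := fun _ => M₂) x y) := by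
  have h := TensorPower.tprod_mul_tprod (R := ℂ) x (fun _ : Fin 1 => y)
  rw [TensorPower.gMul_def] at h
  simp only [consEquiv, LinearEquiv.trans_apply, TensorProduct.comm_tmul,
    TensorProduct.congr_tmul, LinearEquiv.refl_apply,
    PiTensorProduct.subsingletonEquiv_symm_apply']
  rw [h, Fin.append_right_eq_snoc]

/-- The representation of `U_q(sl₂)` on `M₂^{⊗n}`: the trivial one for `n = 0`, and on
`M₂^{⊗(n+1)} = M₂ ⊗ M₂^{⊗n}` the one that is given by the coproduct,
`X.(v' ⊗ v'') = ∑ (X'.v') ⊗ (X''.v'')` for `Δ(X) = ∑ X' ⊗ X''`. -/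
noncomputable def rep (q : GenericParam) : (n : ℕ) → Uq q →ₐ[ℂ] Module.End ℂ (M₂Pow n)
  | 0 => (Algebra.ofId ℂ (Module.End ℂ (M₂Pow 0))).comp (Uq.counit q)
  | n + 1 => ((consEquiv n).conjAlgEquiv ℂ).toAlgHom.comp <|
      (Module.endTensorEndAlgHom (R := ℂ) (S := ℂ) (A := ℂ) (M := M₂) (N := M₂Pow n)).comp <|
        (Algebra.TensorProduct.map (repM₂ q) (rep q n)).comp (Uq.comul q)

theorem rep_succ_K (q : GenericParam) (n : ℕ) (y : M₂) (w : M₂Pow n) :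
    rep q (n + 1) (Uq.K q) (consEquiv n (y ⊗ₜ w)) =
      consEquiv n (repM₂ q (Uq.K q) y ⊗ₜ rep q n (Uq.K q) w) := by
  simp [rep, Uq.comul, LinearEquiv.conjAlgEquiv_apply, Module.endTensorEndAlgHom_apply]

theorem rep_succ_E (q : GenericParam) (n : ℕ) (y : M₂) (w : M₂Pow n) :
    rep q (n + 1) (Uq.E q) (consEquiv n (y ⊗ₜ w)) =
      consEquiv n (repM₂ q (Uq.E q) y ⊗ₜ rep q n (Uq.K q) w + y ⊗ₜ rep q n (Uq.E q) w) := by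
  simp [rep, Uq.comul, LinearEquiv.conjAlgEquiv_apply, Module.endTensorEndAlgHom_apply]

/-! ### Singlet projections -/

/-- The projection `π̂ : M₂ ⊗ M₂ → ℂ` to the singlet, through its values
`π̂(e₀ ⊗ e₀) = π̂(e₁ ⊗ e₁) = 0`, `π̂(e₀ ⊗ e₁) = (q⁻¹ - q) / [2]`,
`π̂(e₁ ⊗ e₀) = (1 - q⁻²) / [2]`, where `[2] = q + q⁻¹`. -/
noncomputable def singletProj (q : GenericParam) : M₂ ⊗[ℂ] M₂ →ₗ[ℂ] ℂ :=
  TensorProduct.lift <| LinearMap.mk₂ ℂ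
    (fun x y => ((q : ℂ)⁻¹ - q) / (q + (q : ℂ)⁻¹) * (x 0 * y 1) +
      (1 - (q : ℂ) ^ (-2 : ℤ)) / (q + (q : ℂ)⁻¹) * (x 1 * y 0))
    (by intros; simp only [Pi.add_apply]; ring)
    (by intros; simp only [Pi.smul_apply, smul_eq_mul]; ring)
    (by intros; simp only [Pi.add_apply]; ring)
    (by intros; simp only [Pi.smul_apply, smul_eq_mul]; ring)

/-- The singlet vector `s = (e₁ ⊗ e₀ - q e₀ ⊗ e₁) / (q - q⁻¹)`. -/
noncomputable def singlet (q : GenericParam) : M₂ ⊗[ℂ] M₂ :=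
  (1 / ((q : ℂ) - (q : ℂ)⁻¹)) • (e 1 ⊗ₜ[ℂ] e 0 - (q : ℂ) • (e 0 ⊗ₜ[ℂ] e 1))

/-- `singletProj` is the projection to the trivial summand of `M₂ ⊗ M₂`: it is `1` on the singlet
vector and vanishes on the basis `e₀ ⊗ e₀`, `q⁻¹ e₀ ⊗ e₁ + e₁ ⊗ e₀`, `[2] e₁ ⊗ e₁`
of the triplet. -/
theorem singletProj_values (q : GenericParam) :
    singletProj q (singlet q) = 1 ∧
    singletProj q (e 0 ⊗ₜ e 0) = 0 ∧
    singletProj q ((q : ℂ)⁻¹ • (e 0 ⊗ₜ e 1) + e 1 ⊗ₜ e 0) = 0 ∧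
    singletProj q (((q : ℂ) + (q : ℂ)⁻¹) • (e 1 ⊗ₜ e 1)) = 0 := by
  have h0 := q.ne_zero
  have h1 := q.sub_inv_ne_zero
  have h2 := q.add_inv_ne_zero
  refine ⟨?_, ?_, ?_, ?_⟩
  · simp [singletProj, singlet, e]
    field_simp
    field_simp at h1 h2
    rw [div_eq_one_iff_eq (mul_ne_zero (div_ne_zero_iff.1 h1).1 (div_ne_zero_iff.1 h2).1)]
    ring
  · simp [singletProj, e]
  · simp [singletProj, e]
    field_simp
    simp
  · simp [singletProj, e]

/-- The increasing enumeration of the positions other than `j` and `j + 1`: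
`i ↦ i` for `i < j` and `i ↦ i + 2` for `i ≥ j`. -/
def skip {n : ℕ} (j : Fin (n + 1)) (i : Fin n) : Fin (n + 2) :=
  if (i : ℕ) < j then ⟨i, by omega⟩ else ⟨i + 2, by omega⟩

theorem skip_val {n : ℕ} (j : Fin (n + 1)) (i : Fin n) :
    (skip j i : ℕ) = if (i : ℕ) < j then (i : ℕ) else i + 2 := by
  unfold skip; split_ifs <;> rfl

theorem skip_strictMono {n : ℕ} (j : Fin (n + 1)) : StrictMono (skip j) := by
  intro a b h
  rw [Fin.lt_def] at h ⊢
  rw [skip_val, skip_val]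
  split_ifs <;> omega

theorem skip_ne {n : ℕ} (j : Fin (n + 1)) (i : Fin n) :
    skip j i ≠ j.castSucc ∧ skip j i ≠ j.succ := by
  simp only [ne_eq, Fin.ext_iff, skip_val, Fin.val_castSucc, Fin.val_succ]
  split_ifs <;> omega

theorem exists_skip_eq {n : ℕ} (j : Fin (n + 1)) (k : Fin (n + 2)) (h₀ : k ≠ j.castSucc)
    (h₁ : k ≠ j.succ) : ∃ i, skip j i = k := by
  simp only [ne_eq, Fin.ext_iff, Fin.val_castSucc, Fin.val_succ] at h₀ h₁
  by_cases h : (k : ℕ) < j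
  · refine ⟨⟨k, by omega⟩, ?_⟩
    rw [Fin.ext_iff, skip_val]
    simp [h]
  · refine ⟨⟨k - 2, by omega⟩, ?_⟩
    rw [Fin.ext_iff, skip_val]
    simp only
    split_ifs <;> omega

/-- The multilinear map underlying `singletProjAt`. -/
noncomputable def singletProjMultilinear (q : GenericParam) {n : ℕ} (j : Fin (n + 1)) :
    MultilinearMap ℂ (fun _ : Fin (n + 2) => M₂) (M₂Pow n) :=
  MultilinearMap.mk'
    (fun x => singletProj q (x j.succ ⊗ₜ x j.castSucc) •
      PiTensorProduct.tprod ℂ (fun i => x (skip j i)))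
    (by
      intro x k a b
      have hne : j.castSucc ≠ j.succ := by simp [Fin.ext_iff]
      by_cases h₀ : k = j.castSucc
      · subst h₀
        simp [Function.update_of_ne (skip_ne j _).1, Function.update_of_ne hne.symm,
          TensorProduct.tmul_add, add_smul]
      by_cases h₁ : k = j.succ
      · subst h₁
        simp [Function.update_of_ne (skip_ne j _).2, Function.update_of_ne hne,
          TensorProduct.add_tmul, add_smul]
      obtain ⟨i, rfl⟩ := exists_skip_eq j k h₀ h₁
      have hu : ∀ c, (fun l => Function.update x (skip j i) c (skip j l)) =
          Function.update (fun l => x (skip j l)) i c := fun c =>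
        Function.update_comp_eq_of_injective x (skip_strictMono j).injective i c
      simp only [hu, Function.update_of_ne (Ne.symm h₀), Function.update_of_ne (Ne.symm h₁),
        MultilinearMap.map_update_add, smul_add])
    (by
      intro x k c a
      have hne : j.castSucc ≠ j.succ := by simp [Fin.ext_iff]
      by_cases h₀ : k = j.castSucc
      · subst h₀
        simp [Function.update_of_ne (skip_ne j _).1, Function.update_of_ne hne.symm,
          TensorProduct.tmul_smul, smul_smul]
      by_cases h₁ : k = j.succ
      · subst h₁
        simp [Function.update_of_ne (skip_ne j _).2, Function.update_of_ne hne,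
          ← TensorProduct.smul_tmul', smul_smul]
      obtain ⟨i, rfl⟩ := exists_skip_eq j k h₀ h₁
      have hu : ∀ c, (fun l => Function.update x (skip j i) c (skip j l)) =
          Function.update (fun l => x (skip j l)) i c := fun c =>
        Function.update_comp_eq_of_injective x (skip_strictMono j).injective i c
      simp only [hu, Function.update_of_ne (Ne.symm h₀), Function.update_of_ne (Ne.symm h₁),
        MultilinearMap.map_update_smul, smul_smul, mul_comm])

/-- The map `id ⊗ π̂ ⊗ id : M₂^{⊗(n+2)} → M₂^{⊗n}`, where `π̂` acts on the two adjacent components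
with indices `j + 1` (left factor) and `j` (right factor). As `j` starts from `0`, this is the
projection in the components `j + 1` and `j + 2` counting from the right, `π̂_{j+1}`. -/
noncomputable def singletProjAt (q : GenericParam) {n : ℕ} (j : Fin (n + 1)) :
    M₂Pow (n + 2) →ₗ[ℂ] M₂Pow n :=
  PiTensorProduct.lift (singletProjMultilinear q j)

theorem singletProjAt_tprod (q : GenericParam) {n : ℕ} (j : Fin (n + 1))
    (x : Fin (n + 2) → M₂) :
    singletProjAt q j (PiTensorProduct.tprod ℂ x) =
      singletProj q (x j.succ ⊗ₜ x j.castSucc) •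
        PiTensorProduct.tprod ℂ (fun i => x (skip j i)) := by
  simp [singletProjAt, singletProjMultilinear]

/-! ### Link patterns -/

/-- A planar pair partition of `n` points on a line (labelled from `0`). A link between `a` and
`b`, where `a < b`, is recorded as `(a, b)`. -/
@[ext] structure PlanarPairing (n : ℕ) where
  /-- The set of links. -/
  links : Finset (Fin n × Fin n)
  lt : ∀ l ∈ links, l.1 < l.2
  partition : ∀ i : Fin n, ∃! l, l ∈ links ∧ (l.1 = i ∨ l.2 = i)
  planar : ∀ l ∈ links, ∀ m ∈ links, l ≠ m →
    0 < ((l.1 : ℤ) - (m.1 : ℤ)) * ((l.2 : ℤ) - (m.2 : ℤ)) *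
      ((l.2 : ℤ) - (m.1 : ℤ)) * ((l.1 : ℤ) - (m.2 : ℤ))

/-- Link patterns of `N` links. -/
abbrev LinkPattern (N : ℕ) : Type := PlanarPairing (2 * N)

/-- The empty link pattern. -/
def emptyPattern : LinkPattern 0 where
  links := ∅
  lt := by simp
  partition := fun i => i.elim0
  planar := by simp

/-- The adjacent points `j` and `j + 1` are linked. -/
def PlanarPairing.HasLink {n : ℕ} (α : PlanarPairing (n + 2)) (j : Fin (n + 1)) : Prop :=
  (j.castSucc, j.succ) ∈ α.links

/-- Removal of the link between `j` and `j + 1`: the remaining links, with the labels greater than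
`j + 1` reduced by two. -/
def PlanarPairing.removeLink {n : ℕ} (α : PlanarPairing (n + 2)) (j : Fin (n + 1))
    (h : α.HasLink j) : PlanarPairing n where
  links := Finset.univ.filter fun l => (skip j l.1, skip j l.2) ∈ α.links
  lt := by
    intro l hl
    simp only [Finset.mem_filter, Finset.mem_univ, true_and] at hl
    exact (skip_strictMono j).lt_iff_lt.1 (α.lt _ hl)
  partition := by
    intro i
    obtain ⟨⟨a, b⟩, ⟨hab, hi⟩, huniq⟩ := α.partition (skip j i)
    have hne : ((a, b) : Fin (n + 2) × Fin (n + 2)) ≠ (j.castSucc, j.succ) := by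
      intro hh
      rw [Prod.mk.injEq] at hh
      rcases hi with hi | hi
      · exact (skip_ne j i).1 (hi.symm.trans hh.1)
      · exact (skip_ne j i).2 (hi.symm.trans hh.2)
    have key : ∀ c, (a = c ∨ b = c) → c ≠ j.castSucc ∧ c ≠ j.succ := by
      intro c hc
      refine ⟨fun hcj => hne ?_, fun hcj => hne ?_⟩
      · exact (α.partition j.castSucc).unique ⟨hab, by rw [← hcj]; exact hc⟩ ⟨h, Or.inl rfl⟩
      · exact (α.partition j.succ).unique ⟨hab, by rw [← hcj]; exact hc⟩ ⟨h, Or.inr rfl⟩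
    obtain ⟨a', rfl⟩ := exists_skip_eq j a (key a (Or.inl rfl)).1 (key a (Or.inl rfl)).2
    obtain ⟨b', rfl⟩ := exists_skip_eq j b (key b (Or.inr rfl)).1 (key b (Or.inr rfl)).2
    have hinj := (skip_strictMono j).injective
    refine ⟨(a', b'), ⟨by simpa using hab, ?_⟩, ?_⟩
    · rcases hi with hi | hi
      · exact Or.inl (hinj hi)
      · exact Or.inr (hinj hi)
    · rintro ⟨c, d⟩ ⟨hcd, hi'⟩
      simp only [Finset.mem_filter, Finset.mem_univ, true_and] at hcd
      have := huniq (skip j c, skip j d) ⟨hcd, by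
        rcases hi' with hi' | hi'
        · exact Or.inl (congrArg (skip j) hi')
        · exact Or.inr (congrArg (skip j) hi')⟩
      rw [Prod.mk.injEq] at this
      exact Prod.ext (hinj this.1) (hinj this.2)
  planar := by
    intro l hl m hm hlm
    simp only [Finset.mem_filter, Finset.mem_univ, true_and] at hl hm
    have hinj := (skip_strictMono j).injective
    have h0 := α.planar _ hl _ hm (by
      intro hh
      rw [Prod.mk.injEq] at hh
      exact hlm (Prod.ext (hinj hh.1) (hinj hh.2)))
    have hs : ∀ a b : Fin n, SignType.sign ((skip j a : ℤ) - (skip j b : ℤ)) =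
        SignType.sign ((a : ℤ) - (b : ℤ)) := by
      intro a b
      rcases lt_trichotomy a b with hab | hab | hab
      · have h1 := skip_strictMono j hab
        rw [Fin.lt_def] at hab h1
        rw [sign_neg (by omega), sign_neg (by omega)]
      · subst hab; simp
      · have h1 := skip_strictMono j hab
        rw [Fin.lt_def] at hab h1
        rw [sign_pos (by omega), sign_pos (by omega)]
    rw [← sign_eq_one_iff] at h0 ⊢
    simpa only [sign_mul, hs] using h0

end MultipleSLE

/-! Call a vector of `M₂^{⊗2N}` invariant if `K` fixes it and `E` kills it.

The kernel lemma `eq_zero_of_singletProjAt_eq_zero` says that, for `N ≥ 1`, an invariant vector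
killed by every `π̂_j` is zero. Being killed by `π̂_j` means that exchanging adjacent letters `0`,
`1` in a word multiplies the coordinate by a fixed power of `q`. Hence, among words with equally
many letters `1`, the coordinate at `s` is a constant times `q ^ positionSum s`. Invariance under
`K` leaves one such class of words, hence one constant `c`, and one coordinate of `E v = 0` reads `c
* ∑_{i ≤ N} q^{2i} = 0` for `2N` components. Since `q` is not a root of unity, `c = 0`. Uniqueness
follows by induction on `N`: the difference of two solutions is killed by every `π̂_j`.

For existence, let `linkFunctional q α` contract each linked pair of components with `π̂`. Adding a
link at `j` to `β` amounts to applying `π̂_j` before the functional of `β`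
(`linkFunctional_addLink`), so by the kernel lemma and induction these functionals separate
invariant vectors. There are at most `catalan N` of them, because left endpoints give an injection
into Dyck words, and the invariants have dimension at least `catalan N` by rank-nullity for `E`. The
functionals therefore form a basis of the dual of the invariants, and the dual basis is the required
collection: the projection conditions can be tested against the functionals. -/

namespace MultipleSLE

/-! ### Coordinates of tensors, indexed by words in the letters 0 and 1 -/

/-- The basis of `M₂^{⊗n}` of tensor products of the basis vectors of `M₂`. -/
noncomputable def stdBasis (n : ℕ) : Module.Basis (Fin n → Fin 2) ℂ (M₂Pow n) :=
  Basis.piTensorProduct fun _ => Pi.basisFun ℂ (Fin 2)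

theorem stdBasis_apply {n : ℕ} (s : Fin n → Fin 2) :
    stdBasis n s = PiTensorProduct.tprod ℂ fun i => e (s i) := by
  simp [stdBasis, e, Pi.basisFun_apply]

/-- The coordinate of a vector of `M₂^{⊗n}` at a word. -/
noncomputable def coord {n : ℕ} (s : Fin n → Fin 2) : M₂Pow n →ₗ[ℂ] ℂ := (stdBasis n).coord s

theorem coord_tprod {n : ℕ} (s : Fin n → Fin 2) (x : Fin n → M₂) :
    coord s (PiTensorProduct.tprod ℂ x) = ∏ i, x i (s i) := by
  simp [coord, stdBasis, Module.Basis.coord_apply]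

theorem eq_of_coord {n : ℕ} {v w : M₂Pow n} (h : ∀ s, coord s v = coord s w) : v = w :=
  (stdBasis n).ext_elem h

theorem coord_stdBasis {n : ℕ} (s t : Fin n → Fin 2) :
    coord s (stdBasis n t) = if t = s then 1 else 0 := by
  simp [coord, Module.Basis.coord_apply, Finsupp.single_apply]

theorem coord_consEquiv {n : ℕ} (s : Fin (n + 1) → Fin 2) (y : M₂) (w : M₂Pow n) :
    coord s (consEquiv n (y ⊗ₜ w)) = y (s (Fin.last n)) * coord (fun i => s i.castSucc) w := by
  have h : (coord s ∘ₗ (consEquiv n).toLinearMap) ∘ₗ TensorProduct.mk ℂ M₂ (M₂Pow n) y =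
      y (s (Fin.last n)) • coord (fun i => s i.castSucc) := by
    ext x
    simp [consEquiv_tmul_tprod, coord_tprod, Fin.prod_univ_castSucc, mul_comm]
  exact LinearMap.congr_fun h w

theorem consEquiv_induction {n : ℕ} {P : M₂Pow (n + 1) → Prop} (zero : P 0)
    (cons : ∀ y w, P (consEquiv n (y ⊗ₜ w))) (add : ∀ v w, P v → P w → P (v + w))
    (v : M₂Pow (n + 1)) : P v := by
  obtain ⟨z, rfl⟩ := (consEquiv n).surjective v
  induction z using TensorProduct.induction_on with
  | zero => simpa using zero
  | tmul y w => exact cons y w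
  | add a b ha hb => simpa using add _ _ ha hb

/-! ### The actions of `K` and `E` in coordinates -/

section Action

variable (q : GenericParam)

theorem repM₂_K_apply (y : M₂) (a : Fin 2) :
    repM₂ q (Uq.K q) y a = (q : ℂ) ^ (if a = 0 then 1 else -1 : ℤ) * y a := by
  fin_cases a <;> simp [repM₂, Matrix.toLinAlgEquiv'_apply, Matrix.mulVec, dotProduct]

theorem repM₂_E_apply (y : M₂) (a : Fin 2) :
    repM₂ q (Uq.E q) y a = if a = 0 then y 1 else 0 := by
  fin_cases a <;> simp [repM₂, Matrix.toLinAlgEquiv'_apply, Matrix.mulVec, dotProduct]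

/-- The weight of a letter: `1` for `0` and `-1` for `1`. -/
def letterWeight (a : Fin 2) : ℤ := if a = 0 then 1 else -1

/-- The weight of a word. -/
def weight {n : ℕ} (s : Fin n → Fin 2) : ℤ := ∑ i, letterWeight (s i)

theorem coord_rep_K {n : ℕ} (s : Fin n → Fin 2) (v : M₂Pow n) :
    coord s (rep q n (Uq.K q) v) = (q : ℂ) ^ weight s * coord s v := by
  induction n with
  | zero => simp [weight, rep, Uq.counit]
  | succ n ih =>
    induction v using consEquiv_induction with
    | zero => simp
    | add v w hv hw => simp only [map_add, hv, hw, mul_add]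
    | cons y w =>
      rw [rep_succ_K, coord_consEquiv, coord_consEquiv, ih, repM₂_K_apply, weight, weight,
        Fin.sum_univ_castSucc, zpow_add₀ q.ne_zero, letterWeight.eq_1 (s (Fin.last n))]
      ring

/-- In the iterated coproduct of `E`, each summand has `E` in one component `i` and `K` in all
components to its right, which are those of smaller index; these produce the power of `q`. -/
theorem coord_rep_E {n : ℕ} (s : Fin n → Fin 2) (v : M₂Pow n) :
    coord s (rep q n (Uq.E q) v) = ∑ i, if s i = 0 then
      (q : ℂ) ^ (∑ k, if k < i then letterWeight (s k) else 0) *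
        coord (Function.update s i 1) v else 0 := by
  induction n with
  | zero => simp [rep, Uq.counit]
  | succ n ih =>
    induction v using consEquiv_induction with
    | zero => simp
    | add v w hv hw =>
      simp only [map_add, hv, hw, mul_add, ← Finset.sum_add_distrib]
      refine Finset.sum_congr rfl fun i _ => ?_
      split_ifs <;> simp
    | cons y w =>
      have hu : ∀ i : Fin n, (fun k : Fin n => Function.update s i.castSucc 1 k.castSucc) =
          Function.update (fun k : Fin n => s k.castSucc) i 1 := fun i =>
        Function.update_comp_eq_of_injective s (Fin.castSucc_injective n) i 1
      have hl : (fun k : Fin n => Function.update s (Fin.last n) 1 k.castSucc) =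
          fun k : Fin n => s k.castSucc := by
        ext k; simp
      rw [rep_succ_E, map_add, map_add, coord_consEquiv, coord_consEquiv, ih, coord_rep_K,
        repM₂_E_apply, Fin.sum_univ_castSucc, add_comm, Finset.mul_sum]
      congr 1
      · refine Finset.sum_congr rfl fun i _ => ?_
        rw [coord_consEquiv, hu, Function.update_of_ne (Fin.castSucc_lt_last i).ne',
          Fin.sum_univ_castSucc]
        simp only [Fin.castSucc_lt_castSucc_iff, (Fin.castSucc_lt_last i).not_gt, if_false,
          add_zero]
        split_ifs <;> ring
      · rw [coord_consEquiv, hl, Fin.sum_univ_castSucc]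
        simp only [Fin.castSucc_lt_last, if_true, lt_self_iff_false, if_false, add_zero,
          Function.update_self, weight]
        split_ifs <;> ring

/-! ### Singlet projections commute with `K` and `E` -/

theorem singletProj_tmul (x y : M₂) : singletProj q (x ⊗ₜ y) =
    ((q : ℂ)⁻¹ - q) / (q + (q : ℂ)⁻¹) * (x 0 * y 1) +
      (1 - (q : ℂ) ^ (-2 : ℤ)) / (q + (q : ℂ)⁻¹) * (x 1 * y 0) := rfl

theorem singletProj_K (x y : M₂) :
    singletProj q (repM₂ q (Uq.K q) x ⊗ₜ repM₂ q (Uq.K q) y) = singletProj q (x ⊗ₜ y) := by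
  have := q.ne_zero
  simp only [singletProj_tmul, repM₂_K_apply]
  simp
  field_simp

theorem singletProj_E (x y : M₂) :
    singletProj q (repM₂ q (Uq.E q) x ⊗ₜ repM₂ q (Uq.K q) y) +
      singletProj q (x ⊗ₜ repM₂ q (Uq.E q) y) = 0 := by
  have := q.ne_zero
  simp only [singletProj_tmul, repM₂_K_apply, repM₂_E_apply]
  simp [zpow_neg]
  field_simp
  ring

theorem singletProjAt_castSucc_consEquiv {n : ℕ} (j : Fin (n + 1)) (y : M₂)
    (w : M₂Pow (n + 2)) : singletProjAt q j.castSucc (consEquiv (n + 2) (y ⊗ₜ w)) =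
      consEquiv n (y ⊗ₜ singletProjAt q j w) := by
  have h : (singletProjAt q j.castSucc ∘ₗ (consEquiv (n + 2)).toLinearMap) ∘ₗ
      TensorProduct.mk ℂ M₂ (M₂Pow (n + 2)) y =
      ((consEquiv n).toLinearMap ∘ₗ TensorProduct.mk ℂ M₂ (M₂Pow n) y) ∘ₗ singletProjAt q j := by
    ext x
    have h1 : skip j.castSucc (Fin.last n) = Fin.last (n + 2) := by
      ext; simp [skip_val]; omega
    have h2 : ∀ i : Fin n, skip j.castSucc i.castSucc = (skip j i).castSucc := by
      intro i; ext; simp [skip_val]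
    simp [consEquiv_tmul_tprod, singletProjAt_tprod, ← Fin.castSucc_succ]
    congr 2
    ext i : 1
    refine Fin.lastCases ?_ (fun i => ?_) i
    · simp [h1]
    · simp [h2]
  exact LinearMap.congr_fun h w

theorem singletProjAt_last_consEquiv {n : ℕ} (y z : M₂) (w : M₂Pow n) :
    singletProjAt q (Fin.last n) (consEquiv (n + 1) (y ⊗ₜ consEquiv n (z ⊗ₜ w))) =
      singletProj q (y ⊗ₜ z) • w := by
  have h : (singletProjAt q (Fin.last n) ∘ₗ (consEquiv (n + 1)).toLinearMap) ∘ₗ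
      TensorProduct.mk ℂ M₂ (M₂Pow (n + 1)) y ∘ₗ (consEquiv n).toLinearMap ∘ₗ
      TensorProduct.mk ℂ M₂ (M₂Pow n) z =
      singletProj q (y ⊗ₜ z) • LinearMap.id := by
    ext x
    have h2 : ∀ i : Fin n, skip (Fin.last n) i = i.castSucc.castSucc := by
      intro i; ext; simp [skip_val]
    simp [consEquiv_tmul_tprod, singletProjAt_tprod, h2]
  exact LinearMap.congr_fun h w

theorem singletProjAt_last_rep_K {n : ℕ} (v : M₂Pow (n + 2)) :
    singletProjAt q (Fin.last n) (rep q (n + 2) (Uq.K q) v) =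
      rep q n (Uq.K q) (singletProjAt q (Fin.last n) v) := by
  induction v using consEquiv_induction with
  | zero => simp
  | add v w hv hw => simp only [map_add, hv, hw]
  | cons y w =>
    induction w using consEquiv_induction with
    | zero => simp
    | add v w hv hw => simp only [TensorProduct.tmul_add, map_add, hv, hw]
    | cons z w =>
      rw [rep_succ_K, rep_succ_K, singletProjAt_last_consEquiv, singletProjAt_last_consEquiv,
        singletProj_K, map_smul]

/-- The coproduct splits off the leftmost component, so components are peeled off from the left
until the projected pair is itself leftmost, the case `Fin.last n`. -/
theorem singletProjAt_rep_K {n : ℕ} (j : Fin (n + 1)) (v : M₂Pow (n + 2)) :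
    singletProjAt q j (rep q (n + 2) (Uq.K q) v) = rep q n (Uq.K q) (singletProjAt q j v) := by
  induction j using Fin.lastCases with
  | last => exact singletProjAt_last_rep_K q v
  | cast j =>
    induction n with
    | zero => exact j.elim0
    | succ n ih =>
      induction v using consEquiv_induction with
      | zero => simp
      | add v w hv hw => simp only [map_add, hv, hw]
      | cons y w =>
        rw [rep_succ_K, singletProjAt_castSucc_consEquiv, singletProjAt_castSucc_consEquiv,
          rep_succ_K]
        induction j using Fin.lastCases with
        | last => rw [singletProjAt_last_rep_K]
        | cast j => rw [ih]

theorem singletProjAt_last_rep_E {n : ℕ} (v : M₂Pow (n + 2)) :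
    singletProjAt q (Fin.last n) (rep q (n + 2) (Uq.E q) v) =
      rep q n (Uq.E q) (singletProjAt q (Fin.last n) v) := by
  induction v using consEquiv_induction with
  | zero => simp
  | add v w hv hw => simp only [map_add, hv, hw]
  | cons y w =>
    induction w using consEquiv_induction with
    | zero => simp
    | add v w hv hw => simp only [TensorProduct.tmul_add, map_add, hv, hw]
    | cons z w =>
      rw [rep_succ_E, rep_succ_E, rep_succ_K]
      simp only [map_add, TensorProduct.tmul_add, singletProjAt_last_consEquiv, map_smul]
      -- The two terms with `E` inside the projected pair cancel, as `E` acts by zero on the trivial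
      -- representation; the term with `E` on the rest survives.
      rw [← add_assoc, ← add_smul, singletProj_E, zero_smul, zero_add]

theorem singletProjAt_rep_E {n : ℕ} (j : Fin (n + 1)) (v : M₂Pow (n + 2)) :
    singletProjAt q j (rep q (n + 2) (Uq.E q) v) = rep q n (Uq.E q) (singletProjAt q j v) := by
  induction j using Fin.lastCases with
  | last => exact singletProjAt_last_rep_E q v
  | cast j =>
    induction n with
    | zero => exact j.elim0
    | succ n ih =>
      induction v using consEquiv_induction with
      | zero => simp
      | add v w hv hw => simp only [map_add, hv, hw]
      | cons y w =>
        rw [rep_succ_E, map_add, map_add, singletProjAt_castSucc_consEquiv,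
          singletProjAt_castSucc_consEquiv, singletProjAt_castSucc_consEquiv,
          rep_succ_E, singletProjAt_rep_K, map_add]
        induction j using Fin.lastCases with
        | last => rw [singletProjAt_last_rep_E]
        | cast j => rw [ih]

/-! ### Singlet projections in coordinates -/

/-- A word with the letters `a` and `b` inserted in the positions `j` and `j + 1`. -/
def insertTwo {n : ℕ} (j : Fin (n + 1)) (a b : Fin 2) (t : Fin n → Fin 2) :
    Fin (n + 2) → Fin 2 := fun k =>
  if h : (k : ℕ) < j then t ⟨k, by omega⟩
  else if h0 : (k : ℕ) = j then a else if h1 : (k : ℕ) = j + 1 then b else t ⟨k - 2, by omega⟩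

theorem insertTwo_skip {n : ℕ} (j : Fin (n + 1)) (a b : Fin 2) (t : Fin n → Fin 2) (i : Fin n) :
    insertTwo j a b t (skip j i) = t i := by
  unfold insertTwo
  have := skip_val j i
  split_ifs at this <;> simp only [this]
  · simp [*]
  · rw [dif_neg (by omega), dif_neg (by omega), dif_neg (by omega)]; simp

theorem insertTwo_castSucc {n : ℕ} (j : Fin (n + 1)) (a b : Fin 2) (t : Fin n → Fin 2) :
    insertTwo j a b t j.castSucc = a := by simp [insertTwo]

theorem insertTwo_succ {n : ℕ} (j : Fin (n + 1)) (a b : Fin 2) (t : Fin n → Fin 2) :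
    insertTwo j a b t j.succ = b := by simp [insertTwo]

theorem prod_eq_mul_mul_prod_skip {n : ℕ} (j : Fin (n + 1)) (f : Fin (n + 2) → ℂ) :
    ∏ k, f k = f j.castSucc * f j.succ * ∏ i, f (skip j i) := by
  classical
  have hne : j.castSucc ≠ j.succ := by simp [Fin.ext_iff]
  have hu : (Finset.univ : Finset (Fin (n + 2))) =
      insert j.castSucc (insert j.succ (Finset.univ.image (skip j))) := by
    ext k
    simp only [Finset.mem_univ, Finset.mem_insert, Finset.mem_image, true_and, true_iff]
    by_cases h₀ : k = j.castSucc
    · exact Or.inl h₀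
    by_cases h₁ : k = j.succ
    · exact Or.inr (Or.inl h₁)
    exact Or.inr (Or.inr (exists_skip_eq j k h₀ h₁))
  rw [hu, Finset.prod_insert, Finset.prod_insert, mul_assoc,
    Finset.prod_image (skip_strictMono j).injective.injOn]
  · simp only [Finset.mem_image, not_exists, not_and]
    exact fun i _ => (skip_ne j i).2
  · simp only [Finset.mem_insert, Finset.mem_image, not_or, not_exists, not_and]
    exact ⟨hne, fun i _ => (skip_ne j i).1⟩

theorem coord_singletProjAt {n : ℕ} (j : Fin (n + 1)) (t : Fin n → Fin 2) (v : M₂Pow (n + 2)) :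
    coord t (singletProjAt q j v) =
      ((q : ℂ)⁻¹ - q) / (q + (q : ℂ)⁻¹) * coord (insertTwo j 1 0 t) v +
      (1 - (q : ℂ) ^ (-2 : ℤ)) / (q + (q : ℂ)⁻¹) * coord (insertTwo j 0 1 t) v := by
  have h : coord t ∘ₗ singletProjAt q j =
      (((q : ℂ)⁻¹ - q) / (q + (q : ℂ)⁻¹)) • coord (insertTwo j 1 0 t) +
      ((1 - (q : ℂ) ^ (-2 : ℤ)) / (q + (q : ℂ)⁻¹)) • coord (insertTwo j 0 1 t) := by
    refine PiTensorProduct.ext (MultilinearMap.ext fun x => ?_)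
    simp only [LinearMap.compMultilinearMap_apply, LinearMap.comp_apply, LinearMap.add_apply,
      LinearMap.smul_apply, singletProjAt_tprod, map_smul, coord_tprod,
      prod_eq_mul_mul_prod_skip j, insertTwo_castSucc, insertTwo_succ, insertTwo_skip,
      smul_eq_mul, singletProj_tmul]
    ring
  exact LinearMap.congr_fun h v

/-- If `π̂_j v = 0`, then the coordinates of `v` at two words that differ by an exchange of
the letters in the positions `j` and `j + 1` are proportional. -/
theorem coord_insertTwo_of_singletProjAt_eq_zero {n : ℕ} {j : Fin (n + 1)} {v : M₂Pow (n + 2)}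
    (h : singletProjAt q j v = 0) (t : Fin n → Fin 2) :
    coord (insertTwo j 0 1 t) v = q * coord (insertTwo j 1 0 t) v := by
  have h1 := coord_singletProjAt q j t v
  rw [h, map_zero] at h1
  have h0 := q.ne_zero
  have h2 := q.sub_inv_ne_zero
  have h3 := q.add_inv_ne_zero
  have h4 : ((q : ℂ) - (q : ℂ)⁻¹) * coord (insertTwo j 0 1 t) v =
      ((q : ℂ) - (q : ℂ)⁻¹) * (q * coord (insertTwo j 1 0 t) v) := by
    -- Both coefficients of `π̂` contain the nonzero factor `q - q⁻¹`, which is cancelled at the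
    -- end.
    have h5 : (1 - (q : ℂ) ^ (-2 : ℤ)) = (q : ℂ)⁻¹ * ((q : ℂ) - (q : ℂ)⁻¹) := by
      rw [zpow_neg]; field_simp
    rw [h5, div_mul_eq_mul_div, div_mul_eq_mul_div, ← add_div, eq_comm, div_eq_zero_iff] at h1
    have h6 := h1.resolve_right h3
    have h7 : (q : ℂ) * (q : ℂ)⁻¹ = 1 := mul_inv_cancel₀ h0
    linear_combination (q : ℂ) * h6 -
      ((q : ℂ) - (q : ℂ)⁻¹) * coord (insertTwo j 0 1 t) v * h7
  exact mul_left_cancel₀ h2 h4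

end Action

theorem insertTwo_self {n : ℕ} (j : Fin (n + 1)) (s : Fin (n + 2) → Fin 2) :
    insertTwo j (s j.castSucc) (s j.succ) (fun i => s (skip j i)) = s := by
  ext k : 1
  by_cases h₀ : k = j.castSucc
  · rw [h₀, insertTwo_castSucc]
  by_cases h₁ : k = j.succ
  · rw [h₁, insertTwo_succ]
  obtain ⟨i, rfl⟩ := exists_skip_eq j k h₀ h₁
  rw [insertTwo_skip]

theorem insertTwo_comp_swap {n : ℕ} (j : Fin (n + 1)) (a b : Fin 2) (t : Fin n → Fin 2) :
    insertTwo j a b t ∘ Equiv.swap j.castSucc j.succ = insertTwo j b a t := by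
  ext k : 1
  by_cases h₀ : k = j.castSucc
  · simp [h₀, insertTwo_castSucc, insertTwo_succ]
  by_cases h₁ : k = j.succ
  · simp [h₁, insertTwo_castSucc, insertTwo_succ]
  obtain ⟨i, rfl⟩ := exists_skip_eq j k h₀ h₁
  simp [Equiv.swap_apply_of_ne_of_ne h₀ h₁, insertTwo_skip]

/-- The sum of the positions of the letters `1` of a word. -/
def positionSum {n : ℕ} (s : Fin n → Fin 2) : ℕ := ∑ i, if s i = 1 then (i : ℕ) else 0

theorem sum_eq_add_add_sum_skip {n : ℕ} (j : Fin (n + 1)) (f : Fin (n + 2) → ℕ) :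
    ∑ k, f k = f j.castSucc + f j.succ + ∑ i, f (skip j i) := by
  -- The additive version is read off from the exponents in the product formula for `2 ^ f k`.
  have := prod_eq_mul_mul_prod_skip j (fun k => (2 : ℂ) ^ f k)
  rw [Finset.prod_pow_eq_pow_sum, Finset.prod_pow_eq_pow_sum, ← pow_add, ← pow_add] at this
  exact_mod_cast Nat.pow_right_injective le_rfl (by exact_mod_cast this)

theorem positionSum_insertTwo {n : ℕ} (j : Fin (n + 1)) (t : Fin n → Fin 2) :
    positionSum (insertTwo j 0 1 t) = positionSum (insertTwo j 1 0 t) + 1 := by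
  simp only [positionSum, sum_eq_add_add_sum_skip j, insertTwo_castSucc, insertTwo_succ,
    insertTwo_skip]
  simp
  omega

/-! ### The kernel lemma -/

section Uniqueness

variable {q : GenericParam}

/-- Moving a letter `1` up by one position raises `positionSum` by one, which matches the factor `q`
in the adjacent exchange; equal letters change nothing. -/
theorem coord_comp_swap {n : ℕ} {v : M₂Pow (n + 2)}
    (hv : ∀ j, singletProjAt q j v = 0) (j : Fin (n + 1)) (s : Fin (n + 2) → Fin 2) :
    (q : ℂ) ^ positionSum s * coord (s ∘ Equiv.swap j.castSucc j.succ) v =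
      (q : ℂ) ^ positionSum (s ∘ Equiv.swap j.castSucc j.succ) * coord s v := by
  have key : ∀ t : Fin n → Fin 2, coord (insertTwo j 0 1 t) v = q * coord (insertTwo j 1 0 t) v :=
    coord_insertTwo_of_singletProjAt_eq_zero q (hv j)
  obtain ⟨a, b, t, rfl⟩ : ∃ a b t, s = insertTwo j a b t := ⟨_, _, _, (insertTwo_self j s).symm⟩
  rw [insertTwo_comp_swap]
  fin_cases a <;> fin_cases b <;>
    simp [key, positionSum_insertTwo, pow_succ] <;> ring

/-- Adjacent transpositions generate all permutations. With `exists_perm_of_ones_eq`, this makes all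
coordinates with a given number of letters `1` multiples of any one of them. -/
theorem coord_comp_perm {n : ℕ} {v : M₂Pow (n + 2)}
    (hv : ∀ j, singletProjAt q j v = 0) (σ : Equiv.Perm (Fin (n + 2))) (s : Fin (n + 2) → Fin 2) :
    (q : ℂ) ^ positionSum s * coord (s ∘ σ) v = (q : ℂ) ^ positionSum (s ∘ σ) * coord s v := by
  have hσ : σ ∈ Submonoid.closure (Set.range fun i : Fin (n + 1) =>
      Equiv.swap i.castSucc i.succ) := by
    rw [Equiv.Perm.mclosure_swap_castSucc_succ]; trivial
  induction hσ using Submonoid.closure_induction generalizing s with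
  | mem σ h => obtain ⟨j, rfl⟩ := h; exact coord_comp_swap hv j s
  | one => simp
  | mul σ τ _ _ hσ hτ =>
    have h1 := hσ s
    have h2 := hτ (s ∘ σ)
    have h0 : (q : ℂ) ^ positionSum (s ∘ σ) ≠ 0 := pow_ne_zero _ q.ne_zero
    rw [Equiv.Perm.coe_mul, ← Function.comp_assoc]
    refine mul_left_cancel₀ h0 ?_
    linear_combination (q : ℂ) ^ positionSum s * h2 + (q : ℂ) ^ positionSum ((s ∘ σ) ∘ τ) * h1

/-- The number of letters `1` of a word. -/
def ones {n : ℕ} (s : Fin n → Fin 2) : ℕ := (Finset.univ.filter fun i => s i = 1).card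

theorem weight_eq {n : ℕ} (s : Fin n → Fin 2) : weight s = n - 2 * ones s := by
  have h : ∀ i, letterWeight (s i) = 1 - 2 * (if s i = 1 then 1 else 0) := by
    intro i
    generalize s i = a
    fin_cases a <;> simp [letterWeight]
  simp only [weight, h, Finset.sum_sub_distrib, ← Finset.mul_sum, ones, Finset.card_filter]
  simp

theorem exists_perm_of_ones_eq {n : ℕ} {s t : Fin n → Fin 2} (h : ones s = ones t) :
    ∃ σ : Equiv.Perm (Fin n), s ∘ σ = t := by
  have h' : Fintype.card {i // t i = 1} = Fintype.card {i // s i = 1} := by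
    rw [Fintype.card_subtype, Fintype.card_subtype]; exact h.symm
  let f := Fintype.equivOfCardEq h'
  refine ⟨f.extendSubtype, ?_⟩
  ext i : 1
  by_cases hi : t i = 1
  · exact (f.extendSubtype_mem i hi).trans hi.symm
  · have := f.extendSubtype_not_mem i hi
    have h2 : ∀ a b : Fin 2, ¬ a = 1 → ¬ b = 1 → a = b := by decide
    exact h2 _ _ this hi

theorem GenericParam.zpow_eq_one {m : ℤ} (h : (q : ℂ) ^ m = 1) : m = 0 := by
  by_contra hm
  have h1 : (q : ℂ) ^ m.natAbs = 1 := by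
    rcases Int.natAbs_eq m with h2 | h2
    · rwa [h2, zpow_natCast] at h
    · rwa [h2, zpow_neg, inv_eq_one, zpow_natCast] at h
  exact q.pow_ne_one (Int.natAbs_pos.2 hm) h1

/-- Distinct integer powers of `q` are distinct, so the `K`-eigenvalue of a vector determines the
weight of the words in its support. -/
theorem coord_eq_zero_of_weight_ne {n : ℕ} {v : M₂Pow n} {m : ℤ}
    (hv : rep q n (Uq.K q) v = (q : ℂ) ^ m • v) {s : Fin n → Fin 2} (hs : weight s ≠ m) :
    coord s v = 0 := by
  have h := coord_rep_K q s v
  rw [hv, map_smul, smul_eq_mul] at h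
  by_contra h0
  have h1 := mul_right_cancel₀ h0 h
  refine hs (sub_eq_zero.1 (GenericParam.zpow_eq_one (q := q) ?_))
  rw [zpow_sub₀ q.ne_zero, h1, div_self (zpow_ne_zero _ q.ne_zero)]

theorem ones_update {n : ℕ} {s : Fin n → Fin 2} {i : Fin n} (h : s i = 0) :
    ones (Function.update s i 1) = ones s + 1 := by
  have : (Finset.univ.filter fun k => Function.update s i 1 k = 1) =
      insert i (Finset.univ.filter fun k => s k = 1) := by
    ext k
    by_cases hk : k = i
    · simp [hk]
    · simp [hk]
  rw [ones, this, Finset.card_insert_of_notMem (by simp [h]), ones]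

theorem positionSum_update {n : ℕ} {s : Fin n → Fin 2} {i : Fin n} (h : s i = 0) :
    positionSum (Function.update s i 1) = positionSum s + i := by
  rw [positionSum, positionSum, ← Finset.add_sum_erase _ _ (Finset.mem_univ i),
    ← Finset.add_sum_erase _ (fun k => if s k = 1 then (k : ℕ) else 0) (Finset.mem_univ i)]
  have : ∑ k ∈ Finset.univ.erase i, (if Function.update s i 1 k = 1 then (k : ℕ) else 0) =
      ∑ k ∈ Finset.univ.erase i, if s k = 1 then (k : ℕ) else 0 :=
    Finset.sum_congr rfl fun k hk => by rw [Function.update_of_ne (Finset.ne_of_mem_erase hk)]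
  simp [this, h, add_comm]

/-- The word of length `2 * N + 2` with the letter `0` in the first `N + 2` positions, and the
letter `1` in the remaining `N` ones. -/
def stepWord (N : ℕ) : Fin (2 * N + 2) → Fin 2 := fun i => if (i : ℕ) < N + 2 then 0 else 1

theorem stepWord_eq_zero_iff {N : ℕ} (i : Fin (2 * N + 2)) :
    stepWord N i = 0 ↔ (i : ℕ) < N + 2 := by
  unfold stepWord; split_ifs <;> simp [*]

theorem ones_stepWord (N : ℕ) : ones (stepWord N) = N := by
  have h : ∀ i : Fin (2 * N + 2), stepWord N i = 1 ↔ N + 2 ≤ (i : ℕ) := by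
    intro i; unfold stepWord; split_ifs <;> simp <;> omega
  simp only [ones, h, Finset.card_filter]
  rw [Fin.sum_univ_eq_sum_range (fun i => if N + 2 ≤ i then 1 else 0), ← Finset.card_filter]
  have : (Finset.range (2 * N + 2)).filter (fun i => N + 2 ≤ i) =
      Finset.Ico (N + 2) (2 * N + 2) := by
    ext i; simp; omega
  rw [this, Nat.card_Ico]; omega

/-- A highest weight vector of weight zero that is annihilated by all singlet projections
vanishes. -/
theorem eq_zero_of_singletProjAt_eq_zero {N : ℕ} {v : M₂Pow (2 * N + 2)}
    (hK : rep q _ (Uq.K q) v = v) (hE : rep q _ (Uq.E q) v = 0)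
    (hv : ∀ j, singletProjAt q j v = 0) : v = 0 := by
  have hq := q.ne_zero
  have h00 : stepWord N 0 = 0 := (stepWord_eq_zero_iff 0).2 (by simp)
  set c := coord (Function.update (stepWord N) 0 1) v with hc
  -- All these words have equally many letters `1`. A letter `1` at position `0` adds nothing to
  -- `positionSum`, and one at `i` adds `i`.
  have hi : ∀ i, stepWord N i = 0 → coord (Function.update (stepWord N) i 1) v =
      (q : ℂ) ^ (i : ℕ) * c := by
    intro i hi
    obtain ⟨σ, hσ⟩ := exists_perm_of_ones_eq (s := Function.update (stepWord N) 0 1)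
      (t := Function.update (stepWord N) i 1) (by rw [ones_update h00, ones_update hi])
    have h := coord_comp_perm hv σ (Function.update (stepWord N) 0 1)
    rw [hσ, positionSum_update h00, positionSum_update hi, Fin.val_zero, add_zero, pow_add,
      mul_assoc] at h
    exact mul_left_cancel₀ (pow_ne_zero _ hq) h
  have hsum := coord_rep_E q (stepWord N) v
  rw [hE, map_zero] at hsum
  have hterm : ∀ i : Fin (2 * N + 2), (if stepWord N i = 0 then
      (q : ℂ) ^ (∑ k, if k < i then letterWeight (stepWord N k) else 0) *
        coord (Function.update (stepWord N) i 1) v else 0) =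
      (fun i : ℕ => if i < N + 2 then ((q : ℂ) ^ 2) ^ i * c else 0) i := by
    intro i
    by_cases h : stepWord N i = 0
    · have h' := (stepWord_eq_zero_iff i).1 h
      -- Every letter below position `i` is `0`, of weight `1`. The resulting `q ^ i` combines with
      -- the `q ^ i` of `hi` to `q ^ (2 * i)`.
      have hw : (∑ k, if k < i then letterWeight (stepWord N k) else 0) = ((i : ℕ) : ℤ) := by
        have : ∀ k, (if k < i then letterWeight (stepWord N k) else 0) =
            if k < i then (1 : ℤ) else 0 := by
          intro k
          split_ifs with hk
          · rw [(stepWord_eq_zero_iff k).2 (by rw [Fin.lt_def] at hk; omega)]; rfl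
          · rfl
        simp only [this, Finset.sum_boole]
        congr 1
        rw [← Fin.card_Iio]; congr 1; ext k; simp
      rw [if_pos h, hi i h, hw, zpow_natCast]
      simp only [h', if_true]
      ring
    · have h' := mt (stepWord_eq_zero_iff i).2 h
      simp [h, h']
  rw [Finset.sum_congr rfl fun i _ => hterm i,
    Fin.sum_univ_eq_sum_range (fun i : ℕ => if i < N + 2 then ((q : ℂ) ^ 2) ^ i * c else 0),
    ← Finset.sum_filter, ← Finset.sum_mul] at hsum
  have hf : (Finset.range (2 * N + 2)).filter (fun i => i < N + 2) = Finset.range (N + 2) := by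
    ext i; simp; omega
  have hq2 : (q : ℂ) ^ 2 ≠ 1 := q.pow_ne_one two_pos
  rw [hf, geom_sum_eq hq2, ← pow_mul, eq_comm, mul_eq_zero, div_eq_zero_iff] at hsum
  have hc0 : c = 0 := by
    refine hsum.resolve_left (not_or.2 ⟨sub_ne_zero.2 (q.pow_ne_one (by omega)), sub_ne_zero.2 hq2⟩)
  refine eq_of_coord fun s => ?_
  rw [map_zero]
  -- Words of weight zero are rearrangements of the word defining `c`; elsewhere the coordinate
  -- vanishes by weight.
  by_cases hs : ones s = N + 1
  · obtain ⟨σ, hσ⟩ := exists_perm_of_ones_eq (s := Function.update (stepWord N) 0 1) (t := s)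
      (by rw [ones_update h00, ones_stepWord, hs])
    have h := coord_comp_perm hv σ (Function.update (stepWord N) 0 1)
    rw [hσ, ← hc, hc0, mul_zero] at h
    exact (mul_eq_zero.1 h).resolve_left (pow_ne_zero _ hq)
  · refine coord_eq_zero_of_weight_ne (q := q) (m := 0) (by simpa using hK) ?_
    rw [weight_eq]; push_cast; omega

end Uniqueness

/-! ### Adding and removing links of planar pairings -/

namespace PlanarPairing

variable {n : ℕ}

theorem fst_injOn_links (α : PlanarPairing n) :
    Set.InjOn Prod.fst (α.links : Set (Fin n × Fin n)) :=
  fun l hl _ hm h => (α.partition l.1).unique ⟨hl, Or.inl rfl⟩ ⟨hm, Or.inl h.symm⟩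

theorem snd_injOn_links (α : PlanarPairing n) :
    Set.InjOn Prod.snd (α.links : Set (Fin n × Fin n)) :=
  fun l hl _ hm h => (α.partition l.2).unique ⟨hl, Or.inr rfl⟩ ⟨hm, Or.inr h.symm⟩

/-- The map on pairs of points that makes room for the points `j` and `j + 1`. -/
def skipPair (j : Fin (n + 1)) (l : Fin n × Fin n) : Fin (n + 2) × Fin (n + 2) :=
  (skip j l.1, skip j l.2)

theorem skipPair_injective (j : Fin (n + 1)) : Function.Injective (skipPair j) := by
  rintro ⟨a, b⟩ ⟨c, d⟩ h
  have hinj := (skip_strictMono j).injective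
  simp only [skipPair, Prod.mk.injEq] at h
  rw [hinj h.1, hinj h.2]

theorem skipPair_ne (j : Fin (n + 1)) (l : Fin n × Fin n) :
    skipPair j l ≠ (j.castSucc, j.succ) := fun h => (skip_ne j l.1).1 (Prod.ext_iff.1 h).1

theorem planar_product_comm (a b c d : ℤ) :
    (a - c) * (b - d) * (b - c) * (a - d) = (c - a) * (d - b) * (d - a) * (c - b) := by ring

/-- A link between neighbours crosses nothing: two consecutive integers, both nonzero, have the same
sign, and the four factors regroup into two such pairs. -/
theorem planar_adjacent {j x y : ℤ} (hx : x ≠ j) (hx' : x ≠ j + 1) (hy : y ≠ j) (hy' : y ≠ j + 1) :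
    0 < (j - x) * (j + 1 - y) * (j + 1 - x) * (j - y) := by
  have key : ∀ z : ℤ, z ≠ j → z ≠ j + 1 → 0 < (j - z) * (j + 1 - z) := by
    intro z h h'
    rcases lt_or_gt_of_ne h with h1 | h1
    · exact mul_pos (by omega) (by omega)
    · exact mul_pos_of_neg_of_neg (by omega) (by omega)
  have := mul_pos (key x hx hx') (key y hy hy')
  linarith

theorem sign_skip_sub (j : Fin (n + 1)) (a b : Fin n) :
    SignType.sign ((skip j a : ℤ) - (skip j b : ℤ)) = SignType.sign ((a : ℤ) - (b : ℤ)) := by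
  rcases lt_trichotomy a b with hab | hab | hab
  · have h1 := skip_strictMono j hab
    rw [Fin.lt_def] at hab h1
    rw [sign_neg (by omega), sign_neg (by omega)]
  · subst hab; simp
  · have h1 := skip_strictMono j hab
    rw [Fin.lt_def] at hab h1
    rw [sign_pos (by omega), sign_pos (by omega)]

/-- Insertion of a link between two new adjacent points `j` and `j + 1`. -/
def addLink (β : PlanarPairing n) (j : Fin (n + 1)) : PlanarPairing (n + 2) where
  links := insert (j.castSucc, j.succ) (β.links.image (skipPair j))
  lt := by
    intro l hl
    rcases Finset.mem_insert.1 hl with rfl | hl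
    · exact j.castSucc_lt_succ
    · obtain ⟨m, hm, rfl⟩ := Finset.mem_image.1 hl
      exact skip_strictMono j (β.lt m hm)
  partition := by
    intro k
    have hne := skip_ne j
    by_cases h : k = j.castSucc ∨ k = j.succ
    · refine ⟨(j.castSucc, j.succ), ⟨Finset.mem_insert_self _ _, ?_⟩, ?_⟩
      · exact h.imp Eq.symm Eq.symm
      · rintro l ⟨hl, hk⟩
        rcases Finset.mem_insert.1 hl with rfl | hl
        · rfl
        · obtain ⟨m, hm, rfl⟩ := Finset.mem_image.1 hl
          exfalso
          rcases hk with rfl | rfl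
          · exact h.elim (hne m.1).1 (hne m.1).2
          · exact h.elim (hne m.2).1 (hne m.2).2
    · rw [not_or] at h
      obtain ⟨i, rfl⟩ := exists_skip_eq j k h.1 h.2
      have hinj := (skip_strictMono j).injective
      obtain ⟨m, ⟨hm, hi⟩, hu⟩ := β.partition i
      refine ⟨skipPair j m, ⟨Finset.mem_insert_of_mem (Finset.mem_image_of_mem _ hm), ?_⟩, ?_⟩
      · exact hi.imp (fun h => congrArg (skip j) h) (fun h => congrArg (skip j) h)
      · rintro l ⟨hl, hk⟩
        rcases Finset.mem_insert.1 hl with rfl | hl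
        · exact absurd hk (not_or.2 ⟨Ne.symm h.1, Ne.symm h.2⟩)
        · obtain ⟨m', hm', rfl⟩ := Finset.mem_image.1 hl
          rw [hu m' ⟨hm', hk.imp (fun x => hinj x) (fun x => hinj x)⟩]
  planar := by
    have hadj : ∀ l : Fin n × Fin n, 0 <
        ((j.castSucc : ℤ) - (skip j l.1 : ℤ)) * ((j.succ : ℤ) - (skip j l.2 : ℤ)) *
        ((j.succ : ℤ) - (skip j l.1 : ℤ)) * ((j.castSucc : ℤ) - (skip j l.2 : ℤ)) := by
      intro l
      have h1 := skip_ne j l.1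
      have h2 := skip_ne j l.2
      simp only [ne_eq, Fin.ext_iff, Fin.val_castSucc, Fin.val_succ] at h1 h2
      have := planar_adjacent (j := (j : ℤ)) (x := skip j l.1) (y := skip j l.2)
        (by omega) (by omega) (by omega) (by omega)
      simpa using this
    intro l hl m hm hlm
    rcases Finset.mem_insert.1 hl with rfl | hl <;> rcases Finset.mem_insert.1 hm with rfl | hm
    · exact absurd rfl hlm
    · obtain ⟨m, hm, rfl⟩ := Finset.mem_image.1 hm
      exact hadj m
    · obtain ⟨l, hl, rfl⟩ := Finset.mem_image.1 hl
      rw [planar_product_comm]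
      exact hadj l
    · obtain ⟨l, hl', rfl⟩ := Finset.mem_image.1 hl
      obtain ⟨m, hm', rfl⟩ := Finset.mem_image.1 hm
      have h0 := β.planar l hl' m hm' (fun h => hlm (by rw [h]))
      rw [← sign_eq_one_iff] at h0 ⊢
      simpa only [sign_mul, skipPair, sign_skip_sub] using h0

theorem hasLink_addLink (β : PlanarPairing n) (j : Fin (n + 1)) : (β.addLink j).HasLink j :=
  Finset.mem_insert_self _ _

theorem addLink_injective (j : Fin (n + 1)) :
    Function.Injective fun β : PlanarPairing n => β.addLink j := by
  intro β γ h
  have hmem : ∀ (β : PlanarPairing n) (l), l ∈ β.links ↔ skipPair j l ∈ (β.addLink j).links := by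
    intro β l
    rw [addLink, Finset.mem_insert, (skipPair_injective j).mem_finset_image]
    simp [skipPair_ne]
  ext l : 2
  rw [hmem β, hmem γ]
  simp only at h
  rw [h]

theorem addLink_removeLink (α : PlanarPairing (n + 2)) (j : Fin (n + 1)) (h : α.HasLink j) :
    (α.removeLink j h).addLink j = α := by
  ext ⟨a, b⟩ : 2
  simp only [addLink, removeLink, Finset.mem_insert, Finset.mem_image, Finset.mem_filter,
    Finset.mem_univ, true_and, skipPair]
  constructor
  · rintro (hl | ⟨m, hm, hl⟩)
    · rw [hl]; exact h
    · rw [← hl]; exact hm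
  · intro hl
    by_cases hne : (a, b) = (j.castSucc, j.succ)
    · exact Or.inl hne
    · have key : ∀ c, (a = c ∨ b = c) → c ≠ j.castSucc ∧ c ≠ j.succ := by
        intro c hc
        refine ⟨fun hcj => hne ?_, fun hcj => hne ?_⟩
        · exact (α.partition j.castSucc).unique ⟨hl, by rw [← hcj]; exact hc⟩ ⟨h, Or.inl rfl⟩
        · exact (α.partition j.succ).unique ⟨hl, by rw [← hcj]; exact hc⟩ ⟨h, Or.inr rfl⟩
      obtain ⟨a', rfl⟩ := exists_skip_eq j a (key a (Or.inl rfl)).1 (key a (Or.inl rfl)).2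
      obtain ⟨b', rfl⟩ := exists_skip_eq j b (key b (Or.inr rfl)).1 (key b (Or.inr rfl)).2
      exact Or.inr ⟨(a', b'), hl, rfl⟩

/-- The point `i` is the left endpoint of a link. -/
def IsLeft (α : PlanarPairing n) (i : Fin n) : Prop := ∃ l ∈ α.links, l.1 = i

theorem isLeft_or (α : PlanarPairing n) (i : Fin n) : α.IsLeft i ∨ ∃ l ∈ α.links, l.2 = i := by
  obtain ⟨l, ⟨hl, h⟩, -⟩ := α.partition i
  exact h.imp (fun h => ⟨l, hl, h⟩) (fun h => ⟨l, hl, h⟩)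

theorem not_isLeft_iff (α : PlanarPairing n) (i : Fin n) :
    ¬ α.IsLeft i ↔ ∃ l ∈ α.links, l.2 = i := by
  refine ⟨(α.isLeft_or i).resolve_left, ?_⟩
  rintro ⟨l, hl, rfl⟩ ⟨m, hm, h⟩
  have := (α.partition l.2).unique ⟨hl, Or.inr rfl⟩ ⟨hm, Or.inl h⟩
  subst this
  exact (α.lt l hl).ne h

/-- Otherwise the links `(j, b)` and `(c, j + 1)` would satisfy `c < j < j + 1 < b` and cross. -/
theorem hasLink_of_isLeft (α : PlanarPairing (n + 2)) (j : Fin (n + 1))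
    (h : α.IsLeft j.castSucc) (h' : ¬ α.IsLeft j.succ) : α.HasLink j := by
  rw [not_isLeft_iff] at h'
  obtain ⟨⟨a, b⟩, hl, rfl : a = j.castSucc⟩ := h
  obtain ⟨⟨c, d⟩, hm, rfl : d = j.succ⟩ := h'
  by_cases heq : ((j.castSucc, b) : Fin (n + 2) × Fin (n + 2)) = (c, j.succ)
  · obtain ⟨rfl, rfl⟩ := Prod.mk.inj heq
    exact hl
  exfalso
  have hp := α.planar _ hl _ hm heq
  have hb : b ≠ j.succ := fun hb => heq (α.snd_injOn_links hl hm hb)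
  have hc : c ≠ j.castSucc := fun hc => heq (α.fst_injOn_links hl hm hc.symm)
  have h1 := α.lt _ hl
  have h2 := α.lt _ hm
  simp only [ne_eq, Fin.ext_iff, Fin.lt_def, Fin.val_castSucc, Fin.val_succ] at hb hc h1 h2
  simp only [Fin.val_castSucc, Fin.val_succ, Nat.cast_add, Nat.cast_one] at hp
  have p1 : (0 : ℤ) < (j : ℤ) - c := by omega
  have p2 : (0 : ℤ) < (b : ℤ) - (j + 1) := by omega
  have p3 : (0 : ℤ) < (b : ℤ) - c := by omega
  have := mul_pos (mul_pos p1 p2) p3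
  nlinarith

theorem isLeft_addLink_skip (β : PlanarPairing n) (j : Fin (n + 1)) (i : Fin n) :
    (β.addLink j).IsLeft (skip j i) ↔ β.IsLeft i := by
  constructor
  · rintro ⟨l, hl, h⟩
    rcases Finset.mem_insert.1 hl with rfl | hl
    · exact absurd h.symm (skip_ne j i).1
    · obtain ⟨m, hm, rfl⟩ := Finset.mem_image.1 hl
      exact ⟨m, hm, (skip_strictMono j).injective h⟩
  · rintro ⟨l, hl, rfl⟩
    exact ⟨_, Finset.mem_insert_of_mem (Finset.mem_image_of_mem _ hl), rfl⟩

/-- The first point is a left endpoint and the last one is not, so the type changes somewhere. -/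
theorem exists_isLeft_not_isLeft (α : PlanarPairing (n + 2)) :
    ∃ j : Fin (n + 1), α.IsLeft j.castSucc ∧ ¬ α.IsLeft j.succ := by
  by_contra! h
  have h0 : α.IsLeft 0 := by
    refine (α.isLeft_or 0).resolve_right ?_
    rintro ⟨l, hl, h0⟩
    have := α.lt l hl
    rw [h0] at this
    exact absurd this (Fin.not_lt_zero _)
  have hall : ∀ i, α.IsLeft i := fun i => Fin.induction h0 (fun j hj => h j hj) i
  obtain ⟨l, hl, h1⟩ := hall (Fin.last _)
  have := α.lt l hl
  rw [h1] at this
  exact absurd this (Fin.le_last _).not_gt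

/-- A planar pairing is determined by the left endpoints of its links. -/
theorem ext_isLeft : ∀ {n : ℕ} {α β : PlanarPairing n}, (∀ i, α.IsLeft i ↔ β.IsLeft i) → α = β
  | 0, α, β, _ => by ext l; exact l.1.elim0
  | 1, α, _, _ => by
    obtain ⟨l, ⟨hl, -⟩, -⟩ := α.partition 0
    have := α.lt l hl
    omega
  | n + 2, α, β, h => by
    -- Both pairings link `j` with `j + 1`, since their left endpoints agree; removing this link
    -- reduces the number of points by two.
    obtain ⟨j, hj, hj'⟩ := α.exists_isLeft_not_isLeft
    have hα := α.addLink_removeLink j (α.hasLink_of_isLeft j hj hj')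
    have hβ := β.addLink_removeLink j (β.hasLink_of_isLeft j ((h _).1 hj) (mt (h _).2 hj'))
    rw [← hα, ← hβ] at h ⊢
    exact congrArg (addLink · j) (ext_isLeft fun i => by
      rw [← isLeft_addLink_skip _ j, h, isLeft_addLink_skip])

/-! ### Link patterns inject into Dyck words -/

section Count

open DyckStep

theorem _root_.List.count_take_ofFn {ι : Type*} [DecidableEq ι] (f : Fin n → ι) (i : ℕ) (a : ι) :
    ((List.ofFn f).take i).count a =
      (Finset.univ.filter fun k : Fin n => (k : ℕ) < i ∧ f k = a).card := by
  have h := List.sum_take_ofFn (fun k => if f k = a then 1 else 0) i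
  have hc : ∀ l : List ι, l.count a = (l.map fun b => if b = a then 1 else 0).sum := by
    intro l
    induction l with
    | nil => simp
    | cons b l ih => simp [List.count_cons, ih, add_comm]
  rw [hc, List.map_take, List.map_ofFn]
  refine h.trans ?_
  rw [← Finset.card_filter, Finset.filter_filter]

open Classical in
/-- The word of up- and down-steps given by the left and right endpoints of the links. -/
noncomputable def steps (α : PlanarPairing n) : List DyckStep :=
  List.ofFn fun i => if α.IsLeft i then U else D

theorem count_take_steps_U (α : PlanarPairing n) (i : ℕ) :
    (α.steps.take i).count U = (α.links.filter fun l => (l.1 : ℕ) < i).card := by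
  rw [steps, List.count_take_ofFn, ← Finset.card_image_of_injOn
    (α.fst_injOn_links.mono (Finset.filter_subset _ _))]
  congr 1
  ext k
  simp only [Finset.mem_filter, Finset.mem_univ, true_and, Finset.mem_image, ite_eq_left_iff,
    reduceCtorEq, imp_false, not_not]
  constructor
  · rintro ⟨h, l, hl, rfl⟩; exact ⟨l, ⟨hl, h⟩, rfl⟩
  · rintro ⟨l, ⟨hl, h⟩, rfl⟩; exact ⟨h, l, hl, rfl⟩

theorem count_take_steps_D (α : PlanarPairing n) (i : ℕ) :
    (α.steps.take i).count D = (α.links.filter fun l => (l.2 : ℕ) < i).card := by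
  rw [steps, List.count_take_ofFn, ← Finset.card_image_of_injOn
    (α.snd_injOn_links.mono (Finset.filter_subset _ _))]
  congr 1
  ext k
  simp only [Finset.mem_filter, Finset.mem_univ, true_and, Finset.mem_image, ite_eq_right_iff,
    reduceCtorEq, imp_false, not_isLeft_iff]
  constructor
  · rintro ⟨h, l, hl, rfl⟩; exact ⟨l, ⟨hl, h⟩, rfl⟩
  · rintro ⟨l, ⟨hl, h⟩, rfl⟩; exact ⟨h, l, hl, rfl⟩

/-- The Dyck word given by the left and right endpoints of the links. -/
noncomputable def toDyckWord (α : PlanarPairing n) : DyckWord where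
  toList := α.steps
  count_U_eq_count_D := by
    have hU := α.count_take_steps_U n
    have hD := α.count_take_steps_D n
    rw [List.take_of_length_le (by simp [steps])] at hU hD
    rw [hU, hD, Finset.filter_true_of_mem fun l _ => l.1.2,
      Finset.filter_true_of_mem fun l _ => l.2.2]
  count_D_le_count_U i := by
    rw [count_take_steps_U, count_take_steps_D]
    -- A link whose right endpoint lies before `i` has its left endpoint there too.
    refine Finset.card_le_card fun l hl => ?_
    rw [Finset.mem_filter] at hl ⊢
    exact ⟨hl.1, lt_trans (α.lt l hl.1) hl.2⟩

theorem toDyckWord_injective : Function.Injective (toDyckWord (n := n)) := by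
  intro α β h
  have h1 : α.steps = β.steps := congrArg DyckWord.toList h
  have h2 := List.ofFn_injective h1
  refine ext_isLeft fun i => ?_
  have h3 := congrFun h2 i
  by_cases ha : α.IsLeft i <;> by_cases hb : β.IsLeft i <;> simp_all

end Count

instance : Finite (PlanarPairing n) :=
  Finite.of_injective PlanarPairing.links fun _ _ h => PlanarPairing.ext h

end PlanarPairing

theorem card_linkPattern_le (N : ℕ) : Nat.card (LinkPattern N) ≤ catalan N := by
  rw [← DyckWord.card_dyckWord_semilength_eq_catalan, ← Nat.card_eq_fintype_card]
  refine Nat.card_le_card_of_injective (fun α => ⟨α.toDyckWord, ?_⟩) fun α β h =>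
    PlanarPairing.toDyckWord_injective (congrArg Subtype.val h)
  have h := α.toDyckWord.two_mul_semilength_eq_length
  have h' : α.toDyckWord.toList.length = 2 * N := by
    simp [PlanarPairing.toDyckWord, PlanarPairing.steps]
  omega

/-! ### Functionals of link patterns -/

section Functional

variable (q : GenericParam)

/-- The functional on `M₂^{⊗n}` that applies the singlet projection to each pair of tensor
components joined by a link. -/
noncomputable def linkFunctional {n : ℕ} (α : PlanarPairing n) : M₂Pow n →ₗ[ℂ] ℂ :=
  -- The larger endpoint `l.2` is the left tensor factor, as components are counted from the right.
  (stdBasis n).constr ℂ fun s => ∏ l ∈ α.links, singletProj q (e (s l.2) ⊗ₜ e (s l.1))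

/-- On a basis word, the factor of the new link is the scalar produced by `π̂_j`, and the other
factors see the word with letters `j` and `j + 1` deleted. -/
theorem linkFunctional_addLink {n : ℕ} (β : PlanarPairing n) (j : Fin (n + 1))
    (v : M₂Pow (n + 2)) :
    linkFunctional q (β.addLink j) v = linkFunctional q β (singletProjAt q j v) := by
  suffices h : linkFunctional q (β.addLink j) = linkFunctional q β ∘ₗ singletProjAt q j from
    LinearMap.congr_fun h v
  refine (stdBasis _).ext fun s => ?_
  rw [LinearMap.comp_apply, stdBasis_apply s, singletProjAt_tprod, ← stdBasis_apply s,
    ← stdBasis_apply fun i => s (skip j i), map_smul, linkFunctional, linkFunctional,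
    Module.Basis.constr_basis, Module.Basis.constr_basis, PlanarPairing.addLink,
    Finset.prod_insert, Finset.prod_image (PlanarPairing.skipPair_injective j).injOn]
  · rfl
  · simp [PlanarPairing.skipPair_ne]

theorem linkFunctional_emptyPattern (v : M₂Pow 0) : linkFunctional q emptyPattern v =
    PiTensorProduct.isEmptyEquiv (R := ℂ) (Fin 0) v := by
  suffices h : linkFunctional q (emptyPattern : PlanarPairing 0) =
      (PiTensorProduct.isEmptyEquiv (R := ℂ) (s := fun _ : Fin 0 => M₂) (Fin 0)).toLinearMap from
    LinearMap.congr_fun h v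
  refine (stdBasis 0).ext fun s => ?_
  rw [linkFunctional, Module.Basis.constr_basis, stdBasis_apply]
  simp [emptyPattern]

end Functional

/-! ### A lower bound for the dimension of the invariants -/

section Dimension

/-- Words correspond to sets of positions. -/
def wordEquivFinset (n : ℕ) : (Fin n → Fin 2) ≃ Finset (Fin n) where
  toFun s := Finset.univ.filter fun i => s i = 1
  invFun S i := if i ∈ S then 1 else 0
  left_inv s := by
    ext i : 1
    have h : ∀ a : Fin 2, (if a = 1 then 1 else 0) = a := by decide
    simp [h]
  right_inv S := by ext i; simp

theorem card_ones_eq (n k : ℕ) : Fintype.card {s : Fin n → Fin 2 // ones s = k} = n.choose k := by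
  have h := Fintype.card_finset_len (α := Fin n) k
  rw [Fintype.card_fin] at h
  rw [← h]
  exact Fintype.card_congr ((wordEquivFinset n).subtypeEquiv fun s => Iff.rfl)

/-- This is the identity `catalan N = (2N choose N) - (2N choose (N-1))`. The condition `ones s + 1
= N` describes the empty set for `N = 0`. -/
theorem catalan_add_card_ones_le (N : ℕ) :
    catalan N + Fintype.card {s : Fin (2 * N) → Fin 2 // ones s + 1 = N} ≤
      Fintype.card {s : Fin (2 * N) → Fin 2 // ones s = N} := by
  rw [card_ones_eq]
  cases N with
  | zero => simp
  | succ M =>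
    simp only [Nat.add_right_cancel_iff]
    rw [card_ones_eq]
    have h1 := succ_mul_catalan_eq_centralBinom (M + 1)
    have h2 := Nat.choose_succ_right_eq (2 * (M + 1)) M
    rw [Nat.centralBinom] at h1
    rw [show 2 * (M + 1) - M = M + 2 by omega] at h2
    refine le_of_eq (Nat.eq_of_mul_eq_mul_left (show 0 < M + 2 by omega) ?_)
    rw [mul_add, show M + 2 = M + 1 + 1 from rfl, h1]
    linarith

variable (q : GenericParam)

/-- The space of highest weight vectors of weight zero in `M₂^{⊗n}`. -/
noncomputable def invariants (n : ℕ) : Submodule ℂ (M₂Pow n) :=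
  LinearMap.ker (rep q n (Uq.K q) - 1) ⊓ LinearMap.ker (rep q n (Uq.E q))

variable {q} in
theorem mem_invariants {n : ℕ} {v : M₂Pow n} :
    v ∈ invariants q n ↔ rep q n (Uq.K q) v = v ∧ rep q n (Uq.E q) v = 0 := by
  simp [invariants, sub_eq_zero]

variable {q} in
theorem singletProjAt_mem_invariants {n : ℕ} {v : M₂Pow (n + 2)} (hv : v ∈ invariants q (n + 2))
    (j : Fin (n + 1)) : singletProjAt q j v ∈ invariants q n := by
  rw [mem_invariants] at hv ⊢
  rw [← singletProjAt_rep_K, ← singletProjAt_rep_E, hv.1, hv.2, map_zero]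
  exact ⟨rfl, rfl⟩

theorem rep_K_mul_E (n : ℕ) (v : M₂Pow n) : rep q n (Uq.K q) (rep q n (Uq.E q) v) =
    (q : ℂ) ^ (2 : ℤ) • rep q n (Uq.E q) (rep q n (Uq.K q) v) := by
  have h := congrArg (fun x => rep q n x v) (Uq.K_mul_E q)
  simpa only [map_mul, map_smul, Module.End.mul_apply, LinearMap.smul_apply] using h

instance (n : ℕ) : FiniteDimensional ℂ (M₂Pow n) :=
  Module.Basis.finiteDimensional_of_finite (stdBasis n)

/-- The inclusion of the vectors supported on the words with `k` letters `1`. -/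
noncomputable def onesInclusion (n k : ℕ) :
    ({s : Fin n → Fin 2 // ones s = k} → ℂ) →ₗ[ℂ] M₂Pow n :=
  Fintype.linearCombination ℂ fun s => stdBasis n s

theorem coord_onesInclusion {n k : ℕ} (f : {s : Fin n → Fin 2 // ones s = k} → ℂ)
    (t : Fin n → Fin 2) :
    coord t (onesInclusion n k f) = if h : ones t = k then f ⟨t, h⟩ else 0 := by
  rw [onesInclusion, Fintype.linearCombination_apply, map_sum]
  simp only [map_smul, coord_stdBasis, smul_eq_mul, mul_ite, mul_one, mul_zero]
  split_ifs with h
  · rw [Finset.sum_eq_single ⟨t, h⟩]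
    · simp
    · intro s _ hs
      rw [if_neg fun hst => hs (Subtype.ext hst)]
    · simp
  · exact Finset.sum_eq_zero fun s _ => if_neg fun hst => h (by rw [← hst]; exact s.2)

theorem onesInclusion_injective (n k : ℕ) : Function.Injective (onesInclusion n k) := by
  intro f g h
  ext s
  have := congrArg (coord s.1) h
  simpa [coord_onesInclusion, s.2] using this

theorem rep_K_onesInclusion {N : ℕ} (f : {s : Fin (2 * N) → Fin 2 // ones s = N} → ℂ) :
    rep q _ (Uq.K q) (onesInclusion (2 * N) N f) = onesInclusion (2 * N) N f := by
  refine eq_of_coord fun s => ?_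
  rw [coord_rep_K, coord_onesInclusion]
  split_ifs with h
  · rw [weight_eq, h]; simp
  · simp

/-- `E` maps weight zero to weight two, so being killed by `E` imposes only as many equations as
there are words of weight two. Rank-nullity leaves a kernel of dimension at least `catalan N`. -/
theorem catalan_le_finrank_invariants (N : ℕ) :
    catalan N ≤ Module.finrank ℂ (invariants q (2 * N)) := by
  let T : ({s : Fin (2 * N) → Fin 2 // ones s = N} → ℂ) →ₗ[ℂ]
      ({s : Fin (2 * N) → Fin 2 // ones s + 1 = N} → ℂ) :=
    LinearMap.pi fun t => coord t.1 ∘ₗ rep q _ (Uq.E q) ∘ₗ onesInclusion (2 * N) N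
  have hmem : ∀ f : LinearMap.ker T, onesInclusion (2 * N) N f ∈ invariants q (2 * N) := by
    intro f
    have hK := rep_K_onesInclusion q f.1
    refine mem_invariants.2 ⟨hK, eq_of_coord fun s => ?_⟩
    rw [map_zero]
    by_cases hs : ones s + 1 = N
    · exact congrFun (LinearMap.mem_ker.1 f.2) ⟨s, hs⟩
    · refine coord_eq_zero_of_weight_ne (q := q) (m := 2) ?_ ?_
      · rw [rep_K_mul_E, hK]
      · rw [weight_eq]; push_cast; omega
  have hinj : Function.Injective ((onesInclusion (2 * N) N ∘ₗ (LinearMap.ker T).subtype).codRestrict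
      (invariants q (2 * N)) hmem) := fun f g h =>
    Subtype.ext (onesInclusion_injective _ _ (congrArg Subtype.val h))
  have h1 := LinearMap.finrank_le_finrank_of_injective hinj
  have h2 := T.finrank_range_add_finrank_ker
  have h3 := Submodule.finrank_le (LinearMap.range T)
  rw [Module.finrank_fintype_fun_eq_card] at h2 h3
  have h4 := catalan_add_card_ones_le N
  omega

end Dimension

/-! ### The dual basis of the link functionals -/

section DualBasis

variable (q : GenericParam)

/-- An invariant vector is determined by its values under the functionals of the link patterns. -/
theorem eq_zero_of_linkFunctional_eq_zero (N : ℕ) (v : M₂Pow (2 * N))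
    (hv : v ∈ invariants q (2 * N)) (h : ∀ α : LinkPattern N, linkFunctional q α v = 0) :
    v = 0 := by
  induction N with
  | zero =>
    have h0 := h emptyPattern
    erw [linkFunctional_emptyPattern] at h0
    exact (LinearEquiv.map_eq_zero_iff _).1 h0
  | succ N ih =>
    obtain ⟨hK, hE⟩ := mem_invariants.1 hv
    refine eq_zero_of_singletProjAt_eq_zero hK hE fun j => ?_
    refine ih _ (singletProjAt_mem_invariants hv j) fun β => ?_
    rw [← linkFunctional_addLink]
    exact h (β.addLink j)

/-- There are invariant vectors dual to the functionals of the link patterns. -/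
theorem exists_dual_vector (N : ℕ) (α : LinkPattern N) : ∃ v ∈ invariants q (2 * N),
    linkFunctional q α v = 1 ∧ ∀ β, β ≠ α → linkFunctional q β v = 0 := by
  classical
  have := Fintype.ofFinite (LinkPattern N)
  let Ψ : invariants q (2 * N) →ₗ[ℂ] (LinkPattern N → ℂ) :=
    LinearMap.pi fun α => linkFunctional q α ∘ₗ (invariants q (2 * N)).subtype
  have hinj : Function.Injective Ψ := by
    rw [injective_iff_map_eq_zero]
    exact fun v hv => Subtype.ext (eq_zero_of_linkFunctional_eq_zero q N v v.2 (congrFun hv))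
  have h1 := LinearMap.finrank_le_finrank_of_injective hinj
  have h2 := catalan_le_finrank_invariants q N
  have h3 := card_linkPattern_le N
  rw [Module.finrank_fintype_fun_eq_card] at h1
  rw [Nat.card_eq_fintype_card] at h3
  -- Injectivity closes the chain `card ≤ catalan N ≤ finrank ≤ card`, so all are equal.
  have hsurj : Function.Surjective Ψ := by
    refine LinearMap.range_eq_top.1 (Submodule.eq_top_of_finrank_eq ?_)
    rw [LinearMap.finrank_range_of_inj hinj, Module.finrank_fintype_fun_eq_card]
    omega
  obtain ⟨v, hv⟩ := hsurj (Pi.single α 1)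
  refine ⟨v, v.2, ?_, fun β hβ => ?_⟩
  · exact (congrFun hv α).trans (Pi.single_eq_same _ _)
  · exact (congrFun hv β).trans (Pi.single_eq_of_ne hβ _)

theorem eq_emptyPattern (α : LinkPattern 0) : α = emptyPattern := by
  ext l; exact l.1.elim0

end DualBasis

end MultipleSLE

/-! ### Existence and uniqueness of the collection -/

open MultipleSLE in
theorem mainTheorem2 (κ : ℝ) (hκ : κ ∈ Set.Ioo (0 : ℝ) 8) (hirr : Irrational κ) :
    ∃! v : (N : ℕ) → LinkPattern N → M₂Pow (2 * N),
      PiTensorProduct.isEmptyEquiv (R := ℂ) (Fin 0) (v 0 emptyPattern) = 1 ∧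
      (∀ (N : ℕ) (α : LinkPattern N),
        rep (qParam κ hirr) (2 * N) (Uq.K (qParam κ hirr)) (v N α) = v N α ∧
        rep (qParam κ hirr) (2 * N) (Uq.E (qParam κ hirr)) (v N α) = 0) ∧
      (∀ (N : ℕ) (α : LinkPattern (N + 1)) (j : Fin (2 * N + 1)),
        (∀ h : α.HasLink j,
          singletProjAt (qParam κ hirr) j (v (N + 1) α) = v N (α.removeLink j h)) ∧
        (¬ α.HasLink j → singletProjAt (qParam κ hirr) j (v (N + 1) α) = 0)) := by
  generalize qParam κ hirr = q
  choose v hv hv1 hv0 using exists_dual_vector q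
  have hdual : ∀ {N : ℕ} (x y : M₂Pow (2 * N)), x ∈ invariants q (2 * N) →
      y ∈ invariants q (2 * N) →
      (∀ β : LinkPattern N, linkFunctional q β x = linkFunctional q β y) → x = y :=
    fun x y hx hy h => sub_eq_zero.1 (eq_zero_of_linkFunctional_eq_zero q _ _
      (Submodule.sub_mem _ hx hy) fun β => by rw [map_sub, h, sub_self])
  have hproj : ∀ (N : ℕ) (α : LinkPattern (N + 1)) (j : Fin (2 * N + 1)),
      (∀ h : α.HasLink j, singletProjAt q j (v (N + 1) α) = v N (α.removeLink j h)) ∧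
      (¬ α.HasLink j → singletProjAt q j (v (N + 1) α) = 0) := by
    refine fun N α j => ⟨fun h => ?_, fun h => ?_⟩
    · refine hdual _ _ (singletProjAt_mem_invariants (hv (N + 1) α) j) (hv _ _) fun β => ?_
      rw [← linkFunctional_addLink]
      by_cases hβ : β = α.removeLink j h
      · rw [hβ, hv1, PlanarPairing.addLink_removeLink]
        exact hv1 (N + 1) α
      · rw [hv0 _ _ _ hβ]
        -- If adding the link to `β` gave `α`, injectivity of adding it would make `β` the pattern
        -- left after its removal.
        refine hv0 (N + 1) α _ fun hα => hβ (PlanarPairing.addLink_injective j ?_)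
        exact hα.trans (α.addLink_removeLink j h).symm
    · refine hdual _ _ (singletProjAt_mem_invariants (hv (N + 1) α) j) (Submodule.zero_mem _)
        fun β => ?_
      rw [← linkFunctional_addLink, map_zero]
      exact hv0 (N + 1) α _ fun hα => h (hα ▸ β.hasLink_addLink j)
  refine ⟨v, ⟨?_, fun N α => mem_invariants.1 (hv N α), hproj⟩, ?_⟩
  · exact (linkFunctional_emptyPattern q _).symm.trans (hv1 0 emptyPattern)
  · rintro w ⟨hw1, hw2, hw3⟩
    funext N
    induction N with
    | zero =>
      funext α
      rw [eq_emptyPattern α]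
      refine (PiTensorProduct.isEmptyEquiv (R := ℂ) (Fin 0)).injective (hw1.trans ?_)
      exact (hv1 0 emptyPattern).symm.trans (linkFunctional_emptyPattern q _)
    | succ N ih =>
      funext α
      have hmem := Submodule.sub_mem _ (mem_invariants.2 (hw2 (N + 1) α)) (hv (N + 1) α)
      obtain ⟨hK, hE⟩ := mem_invariants.1 hmem
      -- The projections of both solutions agree by the induction hypothesis, so the kernel lemma
      -- applies to their difference.
      refine sub_eq_zero.1 (eq_zero_of_singletProjAt_eq_zero hK hE fun j => ?_)
      refine (map_sub (singletProjAt q j) _ _).trans (sub_eq_zero.2 ?_)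
      by_cases h : α.HasLink j
      · exact ((hw3 N α j).1 h).trans ((congrFun ih _).trans ((hproj N α j).1 h).symm)
      · exact ((hw3 N α j).2 h).trans ((hproj N α j).2 h).symm
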